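/- **Setting.** A tropical signomial on $\mathbb{R}^2$ is a tropical sum $g=\bigoplus_{i}\, (b_i\odot x^{\odot c_i})$ of finitely many (at least one) monomials, with coefficients $b_i\in\mathbb{R}$ and real exponent vectors $c_i\in\mathbb{R}^2$; its function is $g(x)=\max_i(\langle c_i,x\rangle+b_i)$. Here $\oplus=\max$, $\odot=+$, $\oslash=-$. It is reduced if deleting monomials always changes the function. For a reduced $g$, $\mathrm{mlen}(g)$ is the number of its monomials; for a factored expression $g_1\odot\cdots\odot g_k$ ($k\ge 1$, all $g_i$ reduced), $\mathrm{flen}(g_1\odot\cdots\odot g_k)=\sum_{i=1}^k \mathrm{mlen}(g_i)-(k-1)$. A representation of $\varphi:\mathbb{R}^2\to\mathbb{R}$ is a pair $g\oslash h$ with $\varphi=g-h$ pointwise, where $g,h$ are reduced (resp. are factored expressions with reduced factors). For $\mathrm{len}\in\{\mathrm{mlen},\mathrm{flen}\}$, representations are preordered by $g\oslash h\preceq g'\oslash h'$ iff $\mathrm{len}(g)\le\mathrm{len}(g')$ and $\mathrm{len}(h)\le \mathrm{len}(h')$, and a representation is minimal if every representation that is $\preceq$ it is also $\succeq$ it. A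 weighted polyhedral complex in $\mathbb{R}^2$ is pure of dimension 1, with nonzero real weights on its 1-cells, considered up to refinement. It is sign-balanced if at every $0$-cell the sum of the unit vectors pointing into the adjacent 1-cells, multiplied by their weights, is zero. It is a polyhedral fan if its cells are cones with a common apex. $X=X_1+X_2$ means that $X$ is the union of $X_1$ and $X_2$ as a set and that its weight function is the sum of theirs (each extended by $0$). $X$ is irreducible if it is not of the form $X_1+X_2$ with $X_1,X_2$ sign-balanced and neither a scalar multiple of the other. For a piecewise linear $\varphi:\mathbb{R}^2\to\mathbb{R}$, $\mathcal{V}(\varphi)$ is the set of points near which $\varphi$ is not affine, as a complex whose weight on a 1-cell is the magnitude of the change of the gradient of $\varphi$ across that cell, taken positive where $\varphi$ is convex and negative where it is concave. **Theorem.** Let $\varphi:\mathbb{R}^2\to\mathbb{R}$ be piecewise linear and suppose that $\mathcal{V}(\varphi)$ is an irreducible polyhedral fan. Then there is a representation $g\oslash h$ of $\varphi$ that is minimal with respect to $\mathrm{mlen}$, and it is unique up to translation: for every $\mathrm{mlen}$-minimal representation $g'\oslash h'$ of $\varphi$ there is an affine function $a$ with $g'=g+a$ and $h'=h+a$ as functions.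 This $g\oslash h$, with $g$ and $h$ as single factors, is also minimal with respect to $\mathrm{flen}$. Moreover, if $(g_1\odot\cdots\odot g_k)\oslash(h_1\odot\cdots\odot h_l)$ is any $\mathrm{flen}$-minimal representation of $\varphi$, then $g_1\odot\cdots\odot g_k$ is a factorization of $g$ and $h_1\odot\cdots\odot h_l$ is a factorization of $h$ up to translation: there is an affine function $a$ with $g_1+\cdots+g_k=g+a$ and $h_1+\cdots+h_l=h+a$. -/

import Mathlib

open Filter Topology
open scoped RealInnerProductSpace

noncomputable section

namespace TropicalFan

/-- The Euclidean plane. -/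
abbrev Plane : Type := EuclideanSpace ℝ (Fin 2)

/-! ### Polyhedra and piecewise linear functions -/

/-- A polyhedron: a finite intersection of closed half-planes. -/
def IsPolyhedron (P : Set Plane) : Prop :=
  ∃ s : Finset (Plane × ℝ), P = {x | ∀ c ∈ s, ⟪c.1, x⟫ ≤ c.2}

/-- `φ` is piecewise linear: finitely many polyhedra cover the plane, and `φ` is affine on each
of them (continuity is automatic). -/
def IsPiecewiseLinear (φ : Plane → ℝ) : Prop :=
  ∃ S : Finset (Set Plane), (∀ P ∈ S, IsPolyhedron P) ∧ (∀ x, ∃ P ∈ S, x ∈ P) ∧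
    ∀ P ∈ S, ∃ a : Plane →ᵃ[ℝ] ℝ, ∀ x ∈ P, φ x = a x

/-- The locus of non-linearity: the points near which `φ` is not affine. -/
def nonlinearityLocus (φ : Plane → ℝ) : Set Plane :=
  {x | ¬ ∃ a : Plane →ᵃ[ℝ] ℝ, ∀ᶠ y in 𝓝 x, φ y = a y}

/-! ### Tropical signomials, their products and their lengths -/

/-- A tropical signomial, as a formal tropical sum of finitely many (at least one) monomials.
The pair `(c, b)` stands for the monomial `x ↦ ⟪c, x⟫ + b`, with real exponents `c`. -/
structure Signomial where
  terms : Finset (Plane × ℝ)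
  nonempty : terms.Nonempty

namespace Signomial

/-- The real-valued function of a tropical signomial: the maximum of its monomials. -/
def eval (g : Signomial) (x : Plane) : ℝ :=
  g.terms.sup' g.nonempty fun m => ⟪m.1, x⟫ + m.2

/-- No monomial is redundant: removing monomials changes the function. (Removing the only
monomial would leave no real-valued function at all.) -/
def IsReduced (g : Signomial) : Prop :=
  ∀ t : Signomial, t.terms ⊂ g.terms → t.eval ≠ g.eval

/-- The monomial length (of a reduced signomial): its number of monomials. -/
def mlen (g : Signomial) : ℕ := g.terms.card

end Signomial

/-- The function of a tropical product `g₁ ⊙ ⋯ ⊙ g_k`: the pointwise sum of the factors. -/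
def tropProd (gs : List Signomial) (x : Plane) : ℝ :=
  (gs.map fun g => g.eval x).sum

/-- The factorization length `∑ mlen gᵢ - (k - 1)` of a factored expression `g₁ ⊙ ⋯ ⊙ g_k`,
for `k ≥ 1`. (The subtraction does not truncate, because each `mlen gᵢ` is at least `1`.) -/
def flen (gs : List Signomial) : ℕ :=
  (gs.map Signomial.mlen).sum - (gs.length - 1)

/-- `(g₁ ⊙ ⋯ ⊙ g_k) ⊘ (h₁ ⊙ ⋯ ⊙ h_l)` represents `φ`, where `k, l ≥ 1` and all factors are
reduced. -/
def IsFactoredRep (φ : Plane → ℝ) (gs hs : List Signomial) : Prop :=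
  gs ≠ [] ∧ hs ≠ [] ∧ (∀ g ∈ gs, g.IsReduced) ∧ (∀ h ∈ hs, h.IsReduced) ∧
    ∀ x, φ x = tropProd gs x - tropProd hs x

/-- `g ⊘ h` represents `φ`, where `g` and `h` are reduced tropical signomials. -/
def IsRep (φ : Plane → ℝ) (g h : Signomial) : Prop :=
  g.IsReduced ∧ h.IsReduced ∧ ∀ x, φ x = g.eval x - h.eval x

/-- `g ⊘ h` is a representation of `φ` that is minimal for the preorder comparing the monomial
lengths of numerators and of denominators: every representation below it is also above it. -/
def IsMlenMinimal (φ : Plane → ℝ) (g h : Signomial) : Prop :=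
  IsRep φ g h ∧ ∀ g' h' : Signomial, IsRep φ g' h' →
    g'.mlen ≤ g.mlen → h'.mlen ≤ h.mlen → g.mlen ≤ g'.mlen ∧ h.mlen ≤ h'.mlen

/-- The same for factored representations and the factorization length. -/
def IsFlenMinimal (φ : Plane → ℝ) (gs hs : List Signomial) : Prop :=
  IsFactoredRep φ gs hs ∧ ∀ gs' hs' : List Signomial, IsFactoredRep φ gs' hs' →
    flen gs' ≤ flen gs → flen hs' ≤ flen hs → flen gs ≤ flen gs' ∧ flen hs ≤ flen hs'

/-! ### Weighted polyhedral complexes of dimension one in the plane -/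

/-- A polyhedral complex in the plane, pure of dimension 1, with real nonzero weights (of either
sign) on its 1-cells. The 1-cells are the sets of nonzero weight; the 0-cells are their faces,
hence need not be listed. Distinct 1-cells meet in a common (possibly empty) face. -/
structure WeightedComplex where
  weight : Set Plane →₀ ℝ
  isPolyhedron : ∀ σ ∈ weight.support, IsPolyhedron σ
  finrank_eq_one : ∀ σ ∈ weight.support, Module.finrank ℝ (affineSpan ℝ σ).direction = 1
  isFace : ∀ σ ∈ weight.support, ∀ τ ∈ weight.support, σ ≠ τ → IsExposed ℝ σ (σ ∩ τ)

namespace WeightedComplex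

/-- The finite set of 1-cells. -/
def cells (X : WeightedComplex) : Finset (Set Plane) := X.weight.support

/-- The underlying set. -/
def carrier (X : WeightedComplex) : Set Plane := {x | ∃ σ ∈ X.cells, x ∈ σ}

open Classical in
/-- The weight that `X` has along a short segment starting at `p` in the direction `u`: the weight
of the 1-cell that contains this segment (there is at most one when `u ≠ 0`), and `0` if there is
none. For unit vectors `u` this does not change when `X` is refined, and it determines `X` up to
refinement. -/
def germWeight (X : WeightedComplex) (p u : Plane) : ℝ :=
  ∑ σ ∈ X.cells with (∀ᶠ ε : ℝ in 𝓝[>] 0, p + ε • u ∈ σ), X.weight σ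

/-- The balancing condition, weights of either sign being allowed: at every point the sum of the
outgoing unit vectors, multiplied by the weights of their cells, vanishes. (In the relative
interior of a 1-cell the two opposite directions cancel, so this is a condition on 0-cells.) -/
def IsSignBalanced (X : WeightedComplex) : Prop :=
  ∀ p : Plane, ∑ᶠ (u : Plane) (_ : ‖u‖ = 1), X.germWeight p u • u = 0

/-- `X = X₁ + X₂`, up to refinement: `X` is the union of `X₁` and `X₂` and its weight function is
the sum of the two weight functions. -/
def IsSum (X X₁ X₂ : WeightedComplex) : Prop :=
  X.carrier = X₁.carrier ∪ X₂.carrier ∧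
    ∀ p u : Plane, ‖u‖ = 1 → X.germWeight p u = X₁.germWeight p u + X₂.germWeight p u

/-- `X` is a multiple of `Y`, up to refinement. -/
def IsProportion (X Y : WeightedComplex) : Prop :=
  ∃ c : ℝ, ∀ p u : Plane, ‖u‖ = 1 → X.germWeight p u = c * Y.germWeight p u

/-- `X` is irreducible: it is not a sum of two sign-balanced complexes neither of which is a
multiple of the other. -/
def IsIrreducible (X : WeightedComplex) : Prop :=
  ¬ ∃ X₁ X₂ : WeightedComplex, X₁.IsSignBalanced ∧ X₂.IsSignBalanced ∧ IsSum X X₁ X₂ ∧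
    ¬ IsProportion X₁ X₂ ∧ ¬ IsProportion X₂ X₁

/-- `X` is a polyhedral fan: all cells are cones with a common apex `p`. -/
def IsFan (X : WeightedComplex) : Prop :=
  ∃ p : Plane, ∀ σ ∈ X.cells, ∀ x ∈ σ, ∀ t : ℝ, 0 ≤ t → p + t • (x - p) ∈ σ

/-- `X` is the weighted complex `𝒱(φ)`: its underlying set is the locus of non-linearity, and the
gradient of `φ` changes by `X.weight σ • n` when a 1-cell `σ` is crossed in the direction of a
unit normal vector `n`. The weight is positive where `φ` is convex and negative where `φ` is
concave. -/
def IsNonlinearityComplex (X : WeightedComplex) (φ : Plane → ℝ) : Prop :=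
  X.carrier = nonlinearityLocus φ ∧
    ∀ σ ∈ X.cells, ∀ q ∈ intrinsicInterior ℝ σ, ∀ n : Plane, ‖n‖ = 1 →
      (∀ x ∈ σ, ∀ y ∈ σ, ⟪n, x - y⟫ = 0) →
      ∃ b : Plane, ∀ᶠ y in 𝓝 q,
        φ y = φ q + ⟪b, y - q⟫ + X.weight σ * max ⟪n, y - q⟫ 0

end WeightedComplex

end TropicalFan

end

namespace TropicalFan

/-! ### Signomials and affine functions -/

/-! Across each ray of the fan the gradient of `φ` jumps by the weight times the rotated direction.
Around the apex the jumps cancel, so the weights are a linear relation among the unit directions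
(`HasKinks.balanced`). A non-proportional relation w' among the same directions would split the fan
as w' + (w - w'), so irreducibility makes the relation unique up to scale
(`exists_eq_smul_of_isIrreducible`). In the plane this leaves no kinks, two opposite rays of equal
weight, or three pairwise non-parallel rays (`HasKinks.hasLeastRep`). A function locally affine off
the apex is affine, so kinks determine `φ` up to an affine function. Up to sign and an affine
summand `φ` is therefore 0, max(l, 0), max(a, b, 0) or max(0, min(a, b)), where a, b are affine
coordinates.

For each form there is a representation that is least, not just minimal, among all factored ones,
and rigid at its lengths (`HasLeastRep`); every claim of the theorem follows formally
(`HasLeastRep.exists_minimal`). Lower bounds come from convexity: a denominator is convex, so strict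
midpoint convexity of `φ` on a segment passes to every numerator and forces pieces there
(`two_le_flen`, `three_le_flen`). The convex forms are their own numerators.

The core is max(0, min(a, b)), with least lengths 3 and 2. A binomial denominator must compensate
the concave crease a = b > 0, hence breaks along the whole line a = b, with some factor c ≥ 1
(`exists_crease`). The numerator then has four gradients if c > 1, and for no c is it a product of
two binomials up to an affine function, so length 3 forces c = 1 (`crease_eq_one`). -/

theorem exists_monomial (k : Plane →ᵃ[ℝ] ℝ) :
    ∃ m : Plane × ℝ, ∀ x, ⟪m.1, x⟫ + m.2 = k x := by
  refine ⟨((InnerProductSpace.toDual ℝ Plane).symm (LinearMap.toContinuousLinearMap k.linear), k 0),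
    fun x => ?_⟩
  have h := k.decomp
  simp only [InnerProductSpace.toDual_symm_apply]
  exact (congrFun h x).symm

theorem exists_affineMap (m : Plane × ℝ) :
    ∃ k : Plane →ᵃ[ℝ] ℝ, ∀ x, k x = ⟪m.1, x⟫ + m.2 :=
  ⟨(innerₛₗ ℝ m.1).toAffineMap + AffineMap.const ℝ Plane m.2, fun x => by simp⟩

theorem affineMap_midpoint (k : Plane →ᵃ[ℝ] ℝ) (x y : Plane) :
    k (midpoint ℝ x y) = (k x + k y) / 2 := by
  rw [k.map_midpoint, midpoint_eq_smul_add, smul_eq_mul]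
  simp; ring

namespace Signomial

theorem eval_of_card_one (g : Signomial) (hg : g.mlen = 1) :
    ∃ k : Plane →ᵃ[ℝ] ℝ, ∀ x, g.eval x = k x := by
  obtain ⟨t, ht⟩ := g
  obtain ⟨m, rfl⟩ := Finset.card_eq_one.1 hg
  obtain ⟨k, hk⟩ := exists_affineMap m
  exact ⟨k, fun x => by simp [eval, hk]⟩

theorem eval_of_card_two (g : Signomial) (hg : g.mlen = 2) :
    ∃ k₁ k₂ : Plane →ᵃ[ℝ] ℝ, ∀ x, g.eval x = max (k₁ x) (k₂ x) := by
  obtain ⟨t, ht⟩ := g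
  obtain ⟨m, n, -, rfl⟩ := Finset.card_eq_two.1 hg
  obtain ⟨k, hk⟩ := exists_affineMap m
  obtain ⟨l, hl⟩ := exists_affineMap n
  refine ⟨k, l, fun x => ?_⟩
  simp only [eval, hk, hl]
  rw [Finset.sup'_insert (Finset.singleton_nonempty n)]
  simp

theorem eval_of_card_three (g : Signomial) (hg : g.mlen = 3) :
    ∃ k₁ k₂ k₃ : Plane →ᵃ[ℝ] ℝ, ∀ x, g.eval x = max (k₁ x) (max (k₂ x) (k₃ x)) := by
  obtain ⟨t, ht⟩ := g
  obtain ⟨m, n, o, -, -, -, rfl⟩ := Finset.card_eq_three.1 hg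
  obtain ⟨k, hk⟩ := exists_affineMap m
  obtain ⟨l, hl⟩ := exists_affineMap n
  obtain ⟨j, hj⟩ := exists_affineMap o
  refine ⟨k, l, j, fun x => ?_⟩
  simp only [eval, hk, hl, hj]
  rw [Finset.sup'_insert (Finset.insert_nonempty n _),
    Finset.sup'_insert (Finset.singleton_nonempty o)]
  simp

theorem one_le_mlen (g : Signomial) : 1 ≤ g.mlen := g.nonempty.card_pos

theorem exists_eval_eq (k : Plane →ᵃ[ℝ] ℝ) :
    ∃ g : Signomial, g.mlen ≤ 1 ∧ ∀ x, g.eval x = k x := by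
  obtain ⟨m, hm⟩ := exists_monomial k
  exact ⟨⟨{m}, Finset.singleton_nonempty m⟩, le_rfl, fun x => by simp [eval, hm]⟩

theorem exists_eval_eq_max (k l : Plane →ᵃ[ℝ] ℝ) :
    ∃ g : Signomial, g.mlen ≤ 2 ∧ ∀ x, g.eval x = max (k x) (l x) := by
  obtain ⟨m, hm⟩ := exists_monomial k
  obtain ⟨n, hn⟩ := exists_monomial l
  classical
  refine ⟨⟨{m, n}, Finset.insert_nonempty m _⟩, Finset.card_le_two, fun x => ?_⟩
  simp only [eval, ← hm, ← hn]
  rw [Finset.sup'_insert (Finset.singleton_nonempty n)]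
  simp

theorem exists_eval_eq_max₃ (k l j : Plane →ᵃ[ℝ] ℝ) :
    ∃ g : Signomial, g.mlen ≤ 3 ∧ ∀ x, g.eval x = max (k x) (max (l x) (j x)) := by
  obtain ⟨m, hm⟩ := exists_monomial k
  obtain ⟨n, hn⟩ := exists_monomial l
  obtain ⟨o, ho⟩ := exists_monomial j
  classical
  refine ⟨⟨{m, n, o}, Finset.insert_nonempty m _⟩, Finset.card_le_three, fun x => ?_⟩
  simp only [eval, ← hm, ← hn, ← ho]
  rw [Finset.sup'_insert (Finset.insert_nonempty n _),
    Finset.sup'_insert (Finset.singleton_nonempty o)]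
  simp

theorem eval_midpoint_le (g : Signomial) (x y : Plane) :
    g.eval (midpoint ℝ x y) ≤ (g.eval x + g.eval y) / 2 := by
  refine Finset.sup'_le _ _ fun m hm => ?_
  obtain ⟨k, hk⟩ := exists_affineMap m
  have hx : k x ≤ g.eval x := by
    rw [hk]; exact Finset.le_sup' (fun m : Plane × ℝ => ⟪m.1, x⟫ + m.2) hm
  have hy : k y ≤ g.eval y := by
    rw [hk]; exact Finset.le_sup' (fun m : Plane × ℝ => ⟪m.1, y⟫ + m.2) hm
  rw [← hk, affineMap_midpoint]
  linarith

end Signomial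

/-! ### Tropical products of small factorization length -/

theorem tropProd_nil (x : Plane) : tropProd [] x = 0 := rfl

theorem tropProd_cons (g : Signomial) (gs : List Signomial) (x : Plane) :
    tropProd (g :: gs) x = g.eval x + tropProd gs x := by
  simp [tropProd]

theorem tropProd_singleton (g : Signomial) (x : Plane) : tropProd [g] x = g.eval x := by
  simp [tropProd]

theorem flen_singleton (g : Signomial) : flen [g] = g.mlen := by simp [flen]

theorem tropProd_midpoint_le (gs : List Signomial) (x y : Plane) :
    tropProd gs (midpoint ℝ x y) ≤ (tropProd gs x + tropProd gs y) / 2 := by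
  induction gs with
  | nil => simp [tropProd_nil]
  | cons g gs ih =>
    simp only [tropProd_cons]
    linarith [g.eval_midpoint_le x y]

/-- The excess `∑ (mlen gᵢ - 1)` of a factored expression. -/
def excess (gs : List Signomial) : ℕ := (gs.map fun g => g.mlen - 1).sum

theorem excess_cons (g : Signomial) (gs : List Signomial) :
    excess (g :: gs) = g.mlen - 1 + excess gs := by simp [excess]

/-- The excess is additive over the factors, so inductions run on it rather than on `flen`. -/
theorem flen_eq_excess_add_one {gs : List Signomial} (h : gs ≠ []) : flen gs = excess gs + 1 := by
  have key : ∀ l : List Signomial, (l.map Signomial.mlen).sum = excess l + l.length := by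
    intro l
    induction l with
    | nil => simp [excess]
    | cons g l ih =>
      have := g.one_le_mlen
      simp only [List.map_cons, List.sum_cons, ih, excess_cons, List.length_cons]
      omega
  have := List.length_pos_iff.2 h
  rw [flen, key]
  omega

theorem tropProd_of_excess_zero (gs : List Signomial) (h : excess gs = 0) :
    ∃ k : Plane →ᵃ[ℝ] ℝ, ∀ x, tropProd gs x = k x := by
  induction gs with
  | nil => exact ⟨0, fun x => by simp [tropProd_nil]⟩
  | cons g gs ih =>
    rw [excess_cons] at h
    have h1 := g.one_le_mlen
    obtain ⟨k, hk⟩ := ih (by omega)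
    obtain ⟨l, hl⟩ := g.eval_of_card_one (by omega)
    exact ⟨l + k, fun x => by simp [tropProd_cons, hk, hl]⟩

theorem tropProd_of_excess_one (gs : List Signomial) (h : excess gs = 1) :
    ∃ k₁ k₂ : Plane →ᵃ[ℝ] ℝ, ∀ x, tropProd gs x = max (k₁ x) (k₂ x) := by
  induction gs with
  | nil => simp [excess] at h
  | cons g gs ih =>
    rw [excess_cons] at h
    have h1 := g.one_le_mlen
    rcases (by omega : g.mlen = 1 ∨ g.mlen = 2) with h2 | h2
    · obtain ⟨k₁, k₂, hk⟩ := ih (by omega)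
      obtain ⟨l, hl⟩ := g.eval_of_card_one h2
      exact ⟨l + k₁, l + k₂, fun x => by simp [tropProd_cons, hk, hl, max_add_add_left]⟩
    · obtain ⟨k, hk⟩ := tropProd_of_excess_zero gs (by omega)
      obtain ⟨l₁, l₂, hl⟩ := g.eval_of_card_two h2
      exact ⟨l₁ + k, l₂ + k, fun x => by simp [tropProd_cons, hk, hl, max_add_add_right]⟩

/-- One trinomial or two binomials carry the excess; monomial factors are absorbed as affine
functions. Two binomials stay separate as hinges, since their product may have four pieces. -/
theorem tropProd_of_excess_two (gs : List Signomial) (h : excess gs = 2) :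
    (∃ k₁ k₂ k₃ : Plane →ᵃ[ℝ] ℝ, ∀ x, tropProd gs x = max (k₁ x) (max (k₂ x) (k₃ x))) ∨
      ∃ k l₁ l₂ : Plane →ᵃ[ℝ] ℝ, ∀ x, tropProd gs x = k x + max (l₁ x) 0 + max (l₂ x) 0 := by
  induction gs with
  | nil => simp [excess] at h
  | cons g gs ih =>
    rw [excess_cons] at h
    have h1 := g.one_le_mlen
    rcases (by omega : g.mlen = 1 ∨ g.mlen = 2 ∨ g.mlen = 3) with h2 | h2 | h2
    · obtain ⟨l, hl⟩ := g.eval_of_card_one h2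
      rcases ih (by omega) with ⟨k₁, k₂, k₃, hk⟩ | ⟨k, l₁, l₂, hk⟩
      · exact Or.inl ⟨l + k₁, l + k₂, l + k₃, fun x => by
          simp [tropProd_cons, hk, hl, max_add_add_left]⟩
      · exact Or.inr ⟨l + k, l₁, l₂, fun x => by simp [tropProd_cons, hk, hl, add_assoc]⟩
    · obtain ⟨k₁, k₂, hk⟩ := tropProd_of_excess_one gs (by omega)
      obtain ⟨l₁, l₂, hl⟩ := g.eval_of_card_two h2
      refine Or.inr ⟨k₂ + l₂, k₁ - k₂, l₁ - l₂, fun x => ?_⟩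
      simp only [tropProd_cons, hk, hl, AffineMap.coe_add, AffineMap.coe_sub, Pi.add_apply,
        Pi.sub_apply]
      have e : ∀ s t : ℝ, max s t = t + max (s - t) 0 := fun s t => by
        rw [← max_add_add_left]; simp
      rw [e (k₁ x), e (l₁ x)]
      ring
    · obtain ⟨k, hk⟩ := tropProd_of_excess_zero gs (by omega)
      obtain ⟨l₁, l₂, l₃, hl⟩ := g.eval_of_card_three h2
      exact Or.inl ⟨l₁ + k, l₂ + k, l₃ + k, fun x => by
        simp [tropProd_cons, hk, hl, max_add_add_right]⟩

/-! ### Least representations -/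

/-- `φ` has a representation whose two lengths are least among all factored representations, and
which is, up to translation, the only one of these lengths. -/
def HasLeastRep (φ : Plane → ℝ) : Prop :=
  ∃ g h : Signomial, (∀ x, φ x = g.eval x - h.eval x) ∧
    ∀ gs hs : List Signomial, gs ≠ [] → hs ≠ [] → (∀ x, φ x = tropProd gs x - tropProd hs x) →
      g.mlen ≤ flen gs ∧ h.mlen ≤ flen hs ∧ (flen gs = g.mlen → flen hs = h.mlen →
        ∃ a : Plane →ᵃ[ℝ] ℝ, ∀ x, tropProd gs x = g.eval x + a x ∧ tropProd hs x = h.eval x + a x)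

theorem HasLeastRep.of_neg {φ : Plane → ℝ} (h : HasLeastRep fun x => -φ x) : HasLeastRep φ := by
  obtain ⟨g, h, hgh, H⟩ := h
  refine ⟨h, g, fun x => by linarith [hgh x], fun gs hs h1 h2 h3 => ?_⟩
  obtain ⟨i, j, k⟩ := H hs gs h2 h1 fun x => by linarith [h3 x]
  refine ⟨j, i, fun u v => ?_⟩
  obtain ⟨a, ha⟩ := k v u
  exact ⟨a, fun x => (ha x).symm⟩

/-- Comparison with a least representation forces a minimal one to have the same lengths, and then
rigidity applies. -/
theorem HasLeastRep.exists_minimal {φ : Plane → ℝ} (H : HasLeastRep φ) :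
    ∃ g h : Signomial,
      IsMlenMinimal φ g h ∧
      (∀ g' h' : Signomial, IsMlenMinimal φ g' h' →
        ∃ a : Plane →ᵃ[ℝ] ℝ, ∀ x, g'.eval x = g.eval x + a x ∧ h'.eval x = h.eval x + a x) ∧
      IsFlenMinimal φ [g] [h] ∧
      (∀ gs hs : List Signomial, IsFlenMinimal φ gs hs →
        ∃ a : Plane →ᵃ[ℝ] ℝ, ∀ x,
          tropProd gs x = g.eval x + a x ∧ tropProd hs x = h.eval x + a x) := by
  obtain ⟨g, h, hgh, H⟩ := H
  have Hs : ∀ g' h' : Signomial, (∀ x, φ x = g'.eval x - h'.eval x) →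
      g.mlen ≤ g'.mlen ∧ h.mlen ≤ h'.mlen ∧ (g'.mlen = g.mlen → h'.mlen = h.mlen →
        ∃ a : Plane →ᵃ[ℝ] ℝ, ∀ x, g'.eval x = g.eval x + a x ∧ h'.eval x = h.eval x + a x) := by
    intro g' h' e
    have := H [g'] [h'] (by simp) (by simp) (by simpa [tropProd_singleton] using e)
    simpa [tropProd_singleton, flen_singleton] using this
  -- Leastness ranges over unreduced expressions too, so deleting monomials without changing the
  -- function would contradict it.
  have hg : g.IsReduced := fun t ht e => by
    have h1 := (Hs t h (by simpa [e] using hgh)).1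
    exact absurd (Finset.card_lt_card ht) (not_lt.2 h1)
  have hh : h.IsReduced := fun t ht e => by
    have h1 := (Hs g t (by simpa [e] using hgh)).2.1
    exact absurd (Finset.card_lt_card ht) (not_lt.2 h1)
  have hrep : IsRep φ g h := ⟨hg, hh, hgh⟩
  have hfrep : IsFactoredRep φ [g] [h] :=
    ⟨by simp, by simp, by simpa using hg, by simpa using hh, by
      simpa [tropProd_singleton] using hgh⟩
  refine ⟨g, h, ⟨hrep, fun g' h' r _ _ => ?_⟩, fun g' h' m => ?_, ⟨hfrep, fun gs hs r _ _ => ?_⟩,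
    fun gs hs m => ?_⟩
  · exact ⟨(Hs g' h' r.2.2).1, (Hs g' h' r.2.2).2.1⟩
  · obtain ⟨i, j, k⟩ := Hs g' h' m.1.2.2
    obtain ⟨i', j'⟩ := m.2 g h hrep i j
    exact k (le_antisymm i' i) (le_antisymm j' j)
  · rw [flen_singleton, flen_singleton]
    obtain ⟨i, j, -⟩ := H gs hs r.1 r.2.1 r.2.2.2.2
    exact ⟨i, j⟩
  · obtain ⟨i, j, k⟩ := H gs hs m.1.1 m.1.2.1 m.1.2.2.2.2
    obtain ⟨i', j'⟩ := m.2 [g] [h] hfrep (by rwa [flen_singleton]) (by rwa [flen_singleton])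
    rw [flen_singleton] at i' j'
    exact k (le_antisymm i' i) (le_antisymm j' j)

/-! ### Lower bounds for lengths from strict midpoint convexity -/

/-- Adding the convex denominator preserves strict midpoint convexity, so the numerator is not
affine. -/
theorem two_le_flen {φ : Plane → ℝ} {gs hs : List Signomial} (hgs : gs ≠ [])
    (e : ∀ x, φ x = tropProd gs x - tropProd hs x) {X Y : Plane}
    (hXY : φ (midpoint ℝ X Y) < (φ X + φ Y) / 2) : 2 ≤ flen gs := by
  rw [flen_eq_excess_add_one hgs]
  by_contra hlt
  obtain ⟨k, hk⟩ := tropProd_of_excess_zero gs (by omega)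
  have h1 := tropProd_midpoint_le hs X Y
  simp only [e, hk, affineMap_midpoint] at hXY
  linarith

/-- A maximum of two affine functions breaks at most once on a segment, but strictness on both
halves needs a break in each. -/
theorem not_eq_max_of_strict {G : Plane → ℝ} {k₁ k₂ : Plane →ᵃ[ℝ] ℝ}
    (hG : ∀ x, G x = max (k₁ x) (k₂ x)) {X Y : Plane}
    (hX : G (midpoint ℝ (midpoint ℝ X Y) X) < (G (midpoint ℝ X Y) + G X) / 2)
    (hY : G (midpoint ℝ (midpoint ℝ X Y) Y) < (G (midpoint ℝ X Y) + G Y) / 2) : False := by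
  simp only [hG, affineMap_midpoint] at hX hY
  rcases le_total (k₁ X) (k₂ X) with a | a <;> rcases le_total (k₁ Y) (k₂ Y) with b | b <;>
  rcases le_total ((k₁ X + k₁ Y) / 2) ((k₂ X + k₂ Y) / 2) with c | c <;>
  simp only [max_eq_left, max_eq_right, a, b, c, max_lt_iff] at hX hY <;> linarith

theorem three_le_flen {φ : Plane → ℝ} {gs hs : List Signomial} (hgs : gs ≠ [])
    (e : ∀ x, φ x = tropProd gs x - tropProd hs x) {X Y : Plane}
    (hX : φ (midpoint ℝ (midpoint ℝ X Y) X) < (φ (midpoint ℝ X Y) + φ X) / 2)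
    (hY : φ (midpoint ℝ (midpoint ℝ X Y) Y) < (φ (midpoint ℝ X Y) + φ Y) / 2) :
    3 ≤ flen gs := by
  have h2 := two_le_flen hgs e hX
  rw [flen_eq_excess_add_one hgs] at h2 ⊢
  by_contra hlt
  obtain ⟨k₁, k₂, hk⟩ := tropProd_of_excess_one gs (by omega)
  have h1 := tropProd_midpoint_le hs (midpoint ℝ X Y) X
  have h2 := tropProd_midpoint_le hs (midpoint ℝ X Y) Y
  refine not_eq_max_of_strict hk (X := X) (Y := Y) ?_ ?_ <;> simp only [e] at hX hY <;> linarith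

/-- A convex `φ` needs only the zero denominator, a single monomial. Any other denominator of length
one is affine and so determines the numerator; only the bound on numerators remains to be supplied.
-/
theorem hasLeastRep_of_denominator_affine {φ : Plane → ℝ} {g : Signomial}
    (hφ : ∀ x, φ x = g.eval x)
    (H : ∀ gs hs : List Signomial, gs ≠ [] → (∀ x, φ x = tropProd gs x - tropProd hs x) →
      g.mlen ≤ flen gs) : HasLeastRep φ := by
  obtain ⟨h, hh, hh'⟩ := Signomial.exists_eval_eq 0
  have h1 := h.one_le_mlen
  refine ⟨g, h, fun x => by simp [hφ, hh'], fun gs hs a b e => ⟨H gs hs a e, ?_, fun _ i => ?_⟩⟩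
  · rw [flen_eq_excess_add_one b]; omega
  · obtain ⟨k, hk⟩ := tropProd_of_excess_zero hs (by rw [flen_eq_excess_add_one b] at i; omega)
    refine ⟨k, fun x => ?_⟩
    have := e x
    simp only [hφ, hk] at this
    simp only [hh', hk, AffineMap.coe_zero, Pi.zero_apply]
    constructor <;> linarith

theorem hasLeastRep_affine {φ : Plane → ℝ} (A : Plane →ᵃ[ℝ] ℝ) (hφ : ∀ x, φ x = A x) :
    HasLeastRep φ := by
  obtain ⟨g, hg, hg'⟩ := Signomial.exists_eval_eq A
  refine hasLeastRep_of_denominator_affine (g := g) (fun x => by rw [hφ, hg'])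
    fun gs hs a e => ?_
  rw [flen_eq_excess_add_one a]; omega

theorem hasLeastRep_max {φ : Plane → ℝ} (A l : Plane →ᵃ[ℝ] ℝ)
    (hφ : ∀ x, φ x = A x + max (l x) 0) {X Y : Plane} (hX : 0 < l X) (hY : l Y < 0) :
    HasLeastRep φ := by
  obtain ⟨g, hg, hg'⟩ := Signomial.exists_eval_eq_max (A + l) A
  refine hasLeastRep_of_denominator_affine (g := g) (fun x => ?_) fun gs hs a e => ?_
  · rw [hφ, hg', ← max_add_add_left]; simp
  · refine hg.trans (two_le_flen a e (X := X) (Y := Y) ?_)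
    simp only [hφ, affineMap_midpoint]
    rw [max_eq_left hX.le, max_eq_right hY.le]
    rcases max_choice ((l X + l Y) / 2) 0 with h | h <;> rw [h] <;> linarith

/-! ### Affine coordinates -/

/-- `a` and `b` are the affine coordinates with origin `p` and axis vectors `v`, `w`. -/
structure IsChart (a b : Plane →ᵃ[ℝ] ℝ) (p v w : Plane) : Prop where
  fst : ∀ s t : ℝ, a (p + s • v + t • w) = s
  snd : ∀ s t : ℝ, b (p + s • v + t • w) = t
  eq : ∀ x, x = p + a x • v + b x • w

theorem IsChart.midpoint_eq (p v w : Plane) (s t s' t' : ℝ) :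
    midpoint ℝ (p + s • v + t • w) (p + s' • v + t' • w) =
      p + ((s + s') / 2) • v + ((t + t') / 2) • w := by
  rw [midpoint_eq_smul_add, invOf_eq_inv]
  module

theorem affineMap_chart (l : Plane →ᵃ[ℝ] ℝ) (p v w : Plane) :
    ∃ c₀ c₁ c₂ : ℝ, ∀ s t : ℝ, l (p + s • v + t • w) = c₀ + c₁ * s + c₂ * t := by
  refine ⟨l p, l.linear v, l.linear w, fun s t => ?_⟩
  have : p + s • v + t • w = (s • v + t • w) +ᵥ p := by rw [vadd_eq_add]; abel
  rw [this, l.map_vadd]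
  simp; ring

theorem hasLeastRep_tripod {φ : Plane → ℝ} {A a b : Plane →ᵃ[ℝ] ℝ} {p v w : Plane}
    (hc : IsChart a b p v w) (hφ : ∀ x, φ x = A x + max (max (a x) (b x)) 0) :
    HasLeastRep φ := by
  obtain ⟨g, hg, hg'⟩ := Signomial.exists_eval_eq_max₃ (A + a) (A + b) A
  refine hasLeastRep_of_denominator_affine (g := g) (fun x => ?_) fun gs hs e₁ e₂ => ?_
  · rw [hφ, hg', max_assoc, ← max_add_add_left, ← max_add_add_left]; simp
  -- In coordinates (a, b) the segment from (-3, 1) to (1, -3) has midpoint (-1, -1); its halves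
  -- cross the creases b = 0 and a = 0 respectively.
  · refine hg.trans (three_le_flen e₁ e₂ (X := p + (-3 : ℝ) • v + (1 : ℝ) • w)
      (Y := p + (1 : ℝ) • v + (-3 : ℝ) • w) ?_ ?_) <;>
    · obtain ⟨c₀, c₁, c₂, hA⟩ := affineMap_chart A p v w
      simp only [hφ, IsChart.midpoint_eq, hA, hc.fst, hc.snd]
      norm_num
      linarith

/-- Four points with pairwise strict midpoint inequalities need four affine pieces. -/
theorem not_eq_max₃_of_strict {G : Plane → ℝ} {k₁ k₂ k₃ : Plane →ᵃ[ℝ] ℝ}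
    (hG : ∀ x, G x = max (k₁ x) (max (k₂ x) (k₃ x))) (X : Fin 4 → Plane)
    (hX : ∀ i j, i < j → G (midpoint ℝ (X i) (X j)) < (G (X i) + G (X j)) / 2) : False := by
  have hk : ∀ x, ∃ i : Fin 3, G x = ![k₁, k₂, k₃] i x := fun x => by
    rw [hG]
    rcases max_choice (k₁ x) (max (k₂ x) (k₃ x)) with h | h
    · exact ⟨0, h⟩
    · rcases max_choice (k₂ x) (k₃ x) with h' | h'
      · exact ⟨1, h.trans h'⟩
      · exact ⟨2, h.trans h'⟩
  have hle : ∀ x (i : Fin 3), ![k₁, k₂, k₃] i x ≤ G x := fun x i => by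
    rw [hG]; fin_cases i <;> simp
  choose f hf using fun i => hk (X i)
  -- Pigeonhole: two of the points share an active piece, which bounds `G` at their midpoint below
  -- by the average.
  obtain ⟨i, j, hij, hfij⟩ := Fintype.exists_ne_map_eq_of_card_lt f (by simp)
  wlog h : i < j generalizing i j
  · exact this j i hij.symm hfij.symm (lt_of_le_of_ne (not_lt.1 h) hij.symm)
  have h1 := hX i j h
  have h2 := hle (midpoint ℝ (X i) (X j)) (f i)
  rw [affineMap_midpoint] at h2
  rw [hf i, hf j, ← hfij] at h1
  linarith

/-- For c = 0 the left side vanishes, and shifting by c costs at most |c|. So the odd part of a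
hinge is linear up to a bounded error, which excludes two hinges in `crease_eq_one`. -/
theorem abs_max_sub_max_sub_le (c z : ℝ) : |max (c + z) 0 - max (c - z) 0 - z| ≤ |c| := by
  rw [abs_le]
  rcases max_cases (c + z) 0 with h | h <;> rcases max_cases (c - z) 0 with h' | h' <;>
  rcases abs_cases c with h'' | h'' <;> constructor <;> linarith

/-- The product is c² - r²d²; let r tend to 0. -/
theorem eq_zero_of_mul_neg {c d : ℝ} (h : ∀ r : ℝ, 0 < r → r < 1 → (c + r * d) * (c - r * d) < 0) :
    c = 0 := by
  have hd : d ≠ 0 := by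
    rintro rfl
    have := h (1 / 2) (by norm_num) (by norm_num)
    nlinarith [sq_nonneg c]
  by_contra hc
  have hc' := abs_pos.2 hc
  have hd' := abs_pos.2 hd
  -- This r is below 1 and satisfies r|d| ≤ |c|, against c² < r²d².
  have h1 := h (|c| / (|c| + |d|)) (by positivity) (by rw [div_lt_one (by positivity)]; linarith)
  have h2 : |c| / (|c| + |d|) * |d| ≤ |c| := by
    rw [div_mul_eq_mul_div, div_le_iff₀ (by positivity)]
    nlinarith
  have h3 : (|c| / (|c| + |d|) * |d|) ^ 2 ≤ |c| ^ 2 := pow_le_pow_left₀ (by positivity) h2 2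
  rw [mul_pow, sq_abs, sq_abs] at h3
  nlinarith

/-- A convex function with two affine pieces making up for the concave crease `a = b > 0` of
`max 0 (min a b)` is, up to an affine function, a multiple of `max (a - b) 0`. -/
theorem exists_crease {φ H : Plane → ℝ} {A a b k₁ k₂ : Plane →ᵃ[ℝ] ℝ} {p v w : Plane}
    (hc : IsChart a b p v w) (hφ : ∀ x, φ x = A x + max 0 (min (a x) (b x)))
    (hH : ∀ x, H x = max (k₁ x) (k₂ x))
    (hG : ∀ x y, φ (midpoint ℝ x y) + H (midpoint ℝ x y) ≤ (φ x + H x + (φ y + H y)) / 2) :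
    ∃ (B : Plane →ᵃ[ℝ] ℝ) (c : ℝ), 1 ≤ c ∧ ∀ x, H x = B x + c * max (a x - b x) 0 := by
  obtain ⟨A₀, A₁, A₂, hA⟩ := affineMap_chart A p v w
  obtain ⟨m₀, m₁, m₂, hk₁⟩ := affineMap_chart k₁ p v w
  obtain ⟨n₀, n₁, n₂, hk₂⟩ := affineMap_chart k₂ p v w
  -- Cross the crease at (s, s) between (s + r, s - r) and (s - r, s + r). There `φ` is strictly
  -- midpoint concave, so `H` must break: k₁ - k₂ has opposite signs at the ends. The bounds on s
  -- and r keep both ends in the positive quadrant.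
  have key : ∀ s : ℝ, 1 ≤ s → ∀ r : ℝ, 0 < r → r < 1 →
      ((m₀ - n₀ + (m₁ - n₁) * s + (m₂ - n₂) * s) + r * ((m₁ - n₁) - (m₂ - n₂))) *
      ((m₀ - n₀ + (m₁ - n₁) * s + (m₂ - n₂) * s) - r * ((m₁ - n₁) - (m₂ - n₂))) < 0 := by
    intro s hs r hr hr1
    have h1 := hG (p + (s + r) • v + (s - r) • w) (p + (s - r) • v + (s + r) • w)
    simp only [IsChart.midpoint_eq, hφ, hH, hA, hk₁, hk₂, hc.fst, hc.snd] at h1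
    rw [min_eq_right (by linarith : s - r ≤ s + r), min_eq_left (by linarith : s - r ≤ s + r),
      show (s + r + (s - r)) / 2 = s by ring, show (s - r + (s + r)) / 2 = s by ring, min_self,
      max_eq_right (by linarith : (0 : ℝ) ≤ s), max_eq_right (by linarith : (0 : ℝ) ≤ s - r)] at h1
    have h2 := le_max_left (m₀ + m₁ * s + m₂ * s) (n₀ + n₁ * s + n₂ * s)
    have h3 := le_max_right (m₀ + m₁ * s + m₂ * s) (n₀ + n₁ * s + n₂ * s)
    rcases max_cases (m₀ + m₁ * (s + r) + m₂ * (s - r)) (n₀ + n₁ * (s + r) + n₂ * (s - r)) with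
      ⟨h4, h4'⟩ | ⟨h4, h4'⟩ <;>
    rcases max_cases (m₀ + m₁ * (s - r) + m₂ * (s + r)) (n₀ + n₁ * (s - r) + n₂ * (s + r)) with
      ⟨h5, h5'⟩ | ⟨h5, h5'⟩ <;> rw [h4, h5] at h1
    · linarith
    · refine mul_neg_of_pos_of_neg ?_ ?_ <;> linarith
    · refine mul_neg_of_neg_of_pos ?_ ?_ <;> linarith
    · linarith
  -- Vanishing at (1, 1) and (2, 2) makes k₁ - k₂ vanish on the line a = b.
  have z₁ := eq_zero_of_mul_neg (key 1 le_rfl)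
  have z₂ := eq_zero_of_mul_neg (key 2 one_le_two)
  have z₀ : m₀ = n₀ := by linarith
  set c := m₁ - n₁
  have z₃ : m₂ - n₂ = -c := by linarith
  have hd : ∀ x, k₁ x = k₂ x + c * (a x - b x) := fun x => by
    rw [hc.eq x, hk₁, hk₂, hc.fst, hc.snd]
    linear_combination z₀ + b x * z₃
  have hH' : ∃ B : Plane →ᵃ[ℝ] ℝ, ∀ x, H x = B x + |c| * max (a x - b x) 0 := by
    rcases le_total 0 c with h | h
    · refine ⟨k₂, fun x => ?_⟩
      rw [hH, hd, abs_of_nonneg h, mul_max_of_nonneg _ _ h, ← max_add_add_left]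
      simp
    · refine ⟨k₁, fun x => ?_⟩
      have : k₂ x = k₁ x + |c| * (a x - b x) := by rw [hd, abs_of_nonpos h]; ring
      rw [hH, this, mul_max_of_nonneg _ _ (abs_nonneg c), ← max_add_add_left, max_comm]
      simp
  obtain ⟨B, hB⟩ := hH'
  refine ⟨B, |c|, ?_, hB⟩
  obtain ⟨B₀, B₁, B₂, hB'⟩ := affineMap_chart B p v w
  -- On this pair the concave crease contributes an excess of 1/2 at the midpoint and the hinge a
  -- deficit of |c|/2, so |c| ≥ 1.
  have h1 := hG (p + (2 : ℝ) • v + (1 : ℝ) • w) (p + (1 : ℝ) • v + (2 : ℝ) • w)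
  simp only [IsChart.midpoint_eq, hφ, hB, hA, hB', hc.fst, hc.snd] at h1
  norm_num at h1
  linarith

/-- For c = 1 the sum is A + max(a - b, 0, a); for c > 1 its four sectors have distinct gradients.
Two hinges never occur, because the odd part of `G` is not linear up to a bounded error. -/
theorem crease_eq_one {G : Plane → ℝ} {A a b : Plane →ᵃ[ℝ] ℝ} {p v w : Plane} {c : ℝ}
    (hc : IsChart a b p v w) (h1 : 1 ≤ c)
    (hG : ∀ x, G x = A x + max 0 (min (a x) (b x)) + c * max (a x - b x) 0)
    (h3 : (∃ k₁ k₂ k₃ : Plane →ᵃ[ℝ] ℝ, ∀ x, G x = max (k₁ x) (max (k₂ x) (k₃ x))) ∨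
      ∃ k l₁ l₂ : Plane →ᵃ[ℝ] ℝ, ∀ x, G x = k x + max (l₁ x) 0 + max (l₂ x) 0) : c = 1 := by
  obtain ⟨A₀, A₁, A₂, hA⟩ := affineMap_chart A p v w
  have hG' : ∀ s t : ℝ, G (p + s • v + t • w) =
      A₀ + A₁ * s + A₂ * t + max 0 (min s t) + c * max (s - t) 0 := fun s t => by
    rw [hG, hA, hc.fst, hc.snd]
  rcases h3 with ⟨k₁, k₂, k₃, hk⟩ | ⟨k, l₁, l₂, hk⟩
  · by_contra hne
    have h2 : 1 < c := lt_of_le_of_ne h1 (Ne.symm hne)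
    -- One point in each of the four sectors where `G` is affine.
    refine not_eq_max₃_of_strict hk ![p + (-1 : ℝ) • v + (1 : ℝ) • w,
      p + (1 : ℝ) • v + (2 : ℝ) • w, p + (2 : ℝ) • v + (1 : ℝ) • w,
      p + (1 : ℝ) • v + (-1 : ℝ) • w] ?_
    intro i j hij
    fin_cases i <;> fin_cases j <;> simp at hij <;>
      simp only [Fin.zero_eta, Fin.mk_one, Fin.reduceFinMk, Matrix.cons_val, IsChart.midpoint_eq,
        hG'] <;>
      norm_num <;> linarith
  · exfalso
    obtain ⟨K₀, K₁, K₂, hK⟩ := affineMap_chart k p v w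
    obtain ⟨m₀, m₁, m₂, hm⟩ := affineMap_chart l₁ p v w
    obtain ⟨n₀, n₁, n₂, hn⟩ := affineMap_chart l₂ p v w
    -- For f(x) = G(x) - G(-x) in coordinates, f(T, T) - f(T, 0) - f(0, T) = T, while the three
    -- error bounds permit at most 3(|m₀| + |n₀|).
    set T := 3 * (|m₀| + |n₀|) + 1 with hT
    have hT0 : 0 < T := by positivity
    have E : ∀ s t : ℝ, G (p + s • v + t • w) = K₀ + K₁ * s + K₂ * t +
        max (m₀ + (m₁ * s + m₂ * t)) 0 + max (n₀ + (n₁ * s + n₂ * t)) 0 := fun s t => by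
      rw [hk, hK, hm, hn, add_assoc m₀, add_assoc n₀]
    have F : ∀ s t : ℝ, |G (p + s • v + t • w) - G (p + (-s) • v + (-t) • w) -
        ((2 * K₁ + m₁ + n₁) * s + (2 * K₂ + m₂ + n₂) * t)| ≤ |m₀| + |n₀| := fun s t => by
      have h1 := abs_le.1 (abs_max_sub_max_sub_le m₀ (m₁ * s + m₂ * t))
      have h2 := abs_le.1 (abs_max_sub_max_sub_le n₀ (n₁ * s + n₂ * t))
      rw [E, E, show m₀ + (m₁ * -s + m₂ * -t) = m₀ - (m₁ * s + m₂ * t) by ring,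
        show n₀ + (n₁ * -s + n₂ * -t) = n₀ - (n₁ * s + n₂ * t) by ring, abs_le]
      constructor <;> linarith [h1.1, h1.2, h2.1, h2.2]
    have F₁ := abs_le.1 (F T T)
    have F₂ := abs_le.1 (F T 0)
    have F₃ := abs_le.1 (F 0 T)
    simp only [hG'] at F₁ F₂ F₃
    simp [hT0.le] at F₁ F₂ F₃
    linarith [F₁.1, F₁.2, F₂.1, F₂.2, F₃.1, F₃.2]

theorem hasLeastRep_mixed {φ : Plane → ℝ} {A a b : Plane →ᵃ[ℝ] ℝ} {p v w : Plane}
    (hc : IsChart a b p v w) (hφ : ∀ x, φ x = A x + max 0 (min (a x) (b x))) :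
    HasLeastRep φ := by
  obtain ⟨g, hg, hg'⟩ := Signomial.exists_eval_eq_max₃ (A + (a - b)) A (A + a)
  obtain ⟨h, hh, hh'⟩ := Signomial.exists_eval_eq_max (a - b) 0
  obtain ⟨A₀, A₁, A₂, hA⟩ := affineMap_chart A p v w
  have hg'' : ∀ x, g.eval x = φ x + max (a x - b x) 0 := fun x => by
    rw [hg', hφ]
    simp only [AffineMap.coe_add, AffineMap.coe_sub, Pi.add_apply, Pi.sub_apply]
    rcases max_cases (a x - b x) 0 with h1 | h1 <;> rcases min_cases (a x) (b x) with h2 | h2 <;>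
    rcases max_cases 0 (min (a x) (b x)) with h3 | h3 <;>
    rcases max_cases (A x) (A x + a x) with h4 | h4 <;>
    rcases max_cases (A x + (a x - b x)) (max (A x) (A x + a x)) with h5 | h5 <;> linarith
  have hh'' : ∀ x, h.eval x = max (a x - b x) 0 := fun x => by simp [hh']
  refine ⟨g, h, fun x => by rw [hg'', hh'']; ring, fun gs hs e₁ e₂ e => ?_⟩
  -- The segment from (4, -1) to (-1, 4) has its midpoint on the concave crease and meets one convex
  -- crease in each half.
  have hgs : 3 ≤ flen gs := by
    refine three_le_flen e₁ e (X := p + (4 : ℝ) • v + (-1 : ℝ) • w)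
      (Y := p + (-1 : ℝ) • v + (4 : ℝ) • w) ?_ ?_ <;>
    · simp only [hφ, IsChart.midpoint_eq, hA, hc.fst, hc.snd]
      norm_num
      linarith
  have hhs : 2 ≤ flen hs := by
    refine two_le_flen e₂ (φ := fun x => -φ x) (hs := gs) (fun x => by linarith [e x])
      (X := p + (2 : ℝ) • v + (1 : ℝ) • w) (Y := p + (1 : ℝ) • v + (2 : ℝ) • w) ?_
    simp only [hφ, IsChart.midpoint_eq, hA, hc.fst, hc.snd]
    norm_num
    linarith
  refine ⟨hg.trans hgs, hh.trans hhs, fun l₁ l₂ => ?_⟩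
  rw [flen_eq_excess_add_one e₁] at l₁ hgs
  rw [flen_eq_excess_add_one e₂] at l₂ hhs
  obtain ⟨k₁, k₂, hk⟩ := tropProd_of_excess_one hs (by omega)
  have hsum : ∀ x, tropProd gs x = φ x + tropProd hs x := fun x => by linarith [e x]
  obtain ⟨B, c, hc1, hB⟩ := exists_crease hc hφ hk fun x y => by
    simp only [← hsum]; exact tropProd_midpoint_le gs x y
  obtain rfl := crease_eq_one (A := A + B) hc hc1
    (fun x => by rw [hsum, hφ, hB, AffineMap.coe_add, Pi.add_apply]; ring)
    (tropProd_of_excess_two gs (by omega))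
  refine ⟨B, fun x => ?_⟩
  rw [hsum, hB, hg'', hh'']
  constructor <;> ring

/-! ### Locally affine functions -/

/-- `f` agrees with an affine function near `x`. -/
def IsAffineNear (f : Plane → ℝ) (x : Plane) : Prop :=
  ∃ A : Plane →ᵃ[ℝ] ℝ, ∀ᶠ y in 𝓝 x, f y = A y

namespace IsAffineNear

variable {f g : Plane → ℝ} {x : Plane}

theorem congr (hf : IsAffineNear f x) (h : ∀ᶠ y in 𝓝 x, g y = f y) : IsAffineNear g x := by
  obtain ⟨A, hA⟩ := hf
  exact ⟨A, by filter_upwards [hA, h] with y h1 h2 using h2.trans h1⟩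

theorem affine (A : Plane →ᵃ[ℝ] ℝ) : IsAffineNear (fun y => A y) x := ⟨A, by simp⟩

theorem const (c : ℝ) : IsAffineNear (fun _ => c) x := ⟨AffineMap.const ℝ Plane c, by simp⟩

theorem inner_sub (n p : Plane) : IsAffineNear (fun y => ⟪n, y - p⟫) x := by
  obtain ⟨A, hA⟩ := exists_affineMap (n, -⟪n, p⟫)
  exact ⟨A, Eventually.of_forall fun y => by
    simp only [hA]; rw [inner_sub_right, sub_eq_add_neg]⟩

theorem add (hf : IsAffineNear f x) (hg : IsAffineNear g x) :
    IsAffineNear (fun y => f y + g y) x := by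
  obtain ⟨A, hA⟩ := hf
  obtain ⟨B, hB⟩ := hg
  exact ⟨A + B, by filter_upwards [hA, hB] with y h1 h2 using by simp [h1, h2]⟩

theorem const_mul (c : ℝ) (hf : IsAffineNear f x) : IsAffineNear (fun y => c * f y) x := by
  obtain ⟨A, hA⟩ := hf
  exact ⟨c • A, by filter_upwards [hA] with y h1 using by simp [h1]⟩

theorem sub (hf : IsAffineNear f x) (hg : IsAffineNear g x) :
    IsAffineNear (fun y => f y - g y) x :=
  (hf.add (hg.const_mul (-1))).congr (Eventually.of_forall fun y => by ring)

theorem neg (hf : IsAffineNear f x) : IsAffineNear (fun y => -f y) x :=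
  (hf.const_mul (-1)).congr (Eventually.of_forall fun y => by ring)

theorem sum {ι : Type*} (s : Finset ι) {F : ι → Plane → ℝ} (h : ∀ i ∈ s, IsAffineNear (F i) x) :
    IsAffineNear (fun y => ∑ i ∈ s, F i y) x := by
  classical
  induction s using Finset.induction_on with
  | empty => simpa using const 0
  | insert i s hi ih =>
    simp only [Finset.sum_insert hi]
    exact (h i (Finset.mem_insert_self i s)).add
      (ih fun j hj => h j (Finset.mem_insert_of_mem hj))

theorem max_inner_sub {n p : Plane} (h : ⟪n, x - p⟫ ≠ 0) :
    IsAffineNear (fun y => max ⟪n, y - p⟫ 0) x := by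
  have hc : Continuous fun y : Plane => ⟪n, y - p⟫ := by fun_prop
  rcases h.lt_or_gt with h | h
  · refine (const 0).congr ?_
    filter_upwards [hc.continuousAt.eventually_lt continuousAt_const h] with y hy
    exact max_eq_right hy.le
  · refine (inner_sub n p).congr ?_
    filter_upwards [continuousAt_const.eventually_lt hc.continuousAt h] with y hy
    exact max_eq_left hy.le

end IsAffineNear

theorem max_neg_zero (z : ℝ) : max (-z) 0 = max z 0 - z := by
  rw [← max_sub_sub_right]; simp [max_comm]

/-- On the line from x to y, a point near x and different from x determines the value at y. -/
theorem affineMap_eq_of_eventuallyEq {A B : Plane →ᵃ[ℝ] ℝ} {x : Plane}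
    (h : ∀ᶠ y in 𝓝 x, A y = B y) : A = B := by
  ext y
  have hc : Tendsto (fun t : ℝ => AffineMap.lineMap x y t) (𝓝[≠] 0) (𝓝 x) := by
    have : Continuous fun t : ℝ => (AffineMap.lineMap x y t : Plane) :=
      AffineMap.lineMap_continuous
    have h0 := this.tendsto 0
    rw [AffineMap.lineMap_apply_zero] at h0
    exact h0.mono_left nhdsWithin_le_nhds
  obtain ⟨t, ht, ht0⟩ := ((hc.eventually h).and self_mem_nhdsWithin).exists
  have hx := h.self_of_nhds
  rw [A.apply_lineMap, B.apply_lineMap, AffineMap.lineMap_apply, AffineMap.lineMap_apply, hx] at ht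
  simp only [vsub_eq_sub, smul_eq_mul, vadd_eq_add, add_left_inj, mul_eq_mul_left_iff,
    sub_left_inj] at ht
  exact ht.resolve_right ht0

/-- Agreeing near a point with a fixed affine map is an open condition. It is also relatively closed
in `S`, since affine germs that share a smaller open set coincide. -/
theorem exists_affineMap_of_isPreconnected {f : Plane → ℝ} {S : Set Plane} (hS : IsPreconnected S)
    (h : ∀ x ∈ S, IsAffineNear f x) :
    ∃ A : Plane →ᵃ[ℝ] ℝ, ∀ x ∈ S, ∀ᶠ y in 𝓝 x, f y = A y := by
  rcases S.eq_empty_or_nonempty with rfl | ⟨x₀, hx₀⟩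
  · exact ⟨0, by simp⟩
  obtain ⟨A, hA⟩ := h x₀ hx₀
  refine ⟨A, hS.subset_of_closure_inter_subset (u := {x | ∀ᶠ y in 𝓝 x, f y = A y})
    isOpen_setOfPred_eventually_nhds ⟨x₀, hx₀, hA⟩ ?_⟩
  rintro x ⟨hx, hxS⟩
  obtain ⟨B, hB⟩ := h x hxS
  obtain ⟨z, hz, hz'⟩ := ((mem_closure_iff_frequently.1 hx).and_eventually
    (eventually_eventually_nhds.2 hB)).exists
  have : A = B := affineMap_eq_of_eventuallyEq (x := z) (by
    filter_upwards [hz, hz'] with y h1 h2 using h1.symm.trans h2)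
  rw [this]
  exact hB

/-- The punctured plane is connected and dense. Normal forms thus need checking only off the apex.
-/
theorem exists_affineMap_of_compl_singleton {f : Plane → ℝ} (hf : Continuous f) (p : Plane)
    (h : ∀ x, x ≠ p → IsAffineNear f x) : ∃ A : Plane →ᵃ[ℝ] ℝ, ∀ x, f x = A x := by
  have hr : 1 < Module.rank ℝ Plane := by
    rw [← Module.finrank_eq_rank, finrank_euclideanSpace_fin]; norm_num
  obtain ⟨A, hA⟩ := exists_affineMap_of_isPreconnected
    (isConnected_compl_singleton_of_one_lt_rank hr p).isPreconnected h
  have e := hf.ext_on (dense_compl_singleton p) A.continuous_of_finiteDimensional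
    fun x hx => (hA x hx).self_of_nhds
  exact ⟨A, fun x => congrFun e x⟩

/-! ### The rotation by a right angle -/

theorem inner_eq_coord (x y : Plane) : ⟪x, y⟫ = x 0 * y 0 + x 1 * y 1 := by
  rw [PiLp.inner_apply, Fin.sum_univ_two]
  simp only [RCLike.inner_apply, conj_trivial]
  ring

theorem coord_sq_of_norm_eq_one {u : Plane} (h : ‖u‖ = 1) : u 0 * u 0 + u 1 * u 1 = 1 := by
  rw [← inner_eq_coord, real_inner_self_eq_norm_sq, h]; norm_num

/-- The rotation by a right angle. -/
def rot (u : Plane) : Plane := !₂[-u 1, u 0]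

@[simp] theorem rot_apply_zero (u : Plane) : rot u 0 = -u 1 := rfl

@[simp] theorem rot_apply_one (u : Plane) : rot u 1 = u 0 := rfl

theorem plane_ext {x y : Plane} (h0 : x 0 = y 0) (h1 : x 1 = y 1) : x = y := by
  ext i; fin_cases i <;> assumption

theorem rot_add (u v : Plane) : rot (u + v) = rot u + rot v :=
  plane_ext (by simp; ring) (by simp)

theorem rot_smul (c : ℝ) (u : Plane) : rot (c • u) = c • rot u :=
  plane_ext (by simp) (by simp)

theorem rot_neg (u : Plane) : rot (-u) = -rot u :=
  plane_ext (by simp) (by simp)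

theorem inner_rot_self (u : Plane) : ⟪rot u, u⟫ = 0 := by
  rw [inner_eq_coord]; simp; ring

theorem inner_rot_rot (u v : Plane) : ⟪rot u, rot v⟫ = ⟪u, v⟫ := by
  rw [inner_eq_coord, inner_eq_coord]; simp; ring

theorem inner_rot_comm (u v : Plane) : ⟪rot u, v⟫ = -⟪rot v, u⟫ := by
  rw [inner_eq_coord, inner_eq_coord]; simp; ring

theorem norm_rot (u : Plane) : ‖rot u‖ = ‖u‖ := by
  rw [norm_eq_sqrt_real_inner, norm_eq_sqrt_real_inner, inner_rot_rot]

theorem eq_smul_of_inner_rot_eq_zero {u x : Plane} (hu : ‖u‖ = 1) (h : ⟪rot u, x⟫ = 0) :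
    x = ⟪u, x⟫ • u := by
  have h1 := coord_sq_of_norm_eq_one hu
  rw [inner_eq_coord] at h
  simp only [rot_apply_zero, rot_apply_one] at h
  refine plane_ext ?_ ?_ <;> simp only [inner_eq_coord, PiLp.smul_apply, smul_eq_mul]
  · linear_combination -x 0 * h1 - u 1 * h
  · linear_combination -x 1 * h1 + u 0 * h

/-- Cramer's rule. -/
theorem inner_rot_smul (v w x : Plane) :
    ⟪rot v, w⟫ • x = ⟪rot v, x⟫ • w - ⟪rot w, x⟫ • v := by
  refine plane_ext ?_ ?_ <;>
    simp only [inner_eq_coord, PiLp.smul_apply, PiLp.sub_apply, smul_eq_mul, rot_apply_zero,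
      rot_apply_one] <;> ring

/-! ### Rays -/

/-- The closed ray from `p` in the direction `u`. -/
def ray (p u : Plane) : Set Plane := {x | ∃ t : ℝ, 0 ≤ t ∧ x = p + t • u}

theorem ray_smul {c : ℝ} (hc : 0 < c) (p u : Plane) : ray p (c • u) = ray p u := by
  ext x
  constructor
  · rintro ⟨t, ht, rfl⟩
    exact ⟨t * c, by positivity, by rw [mul_smul]⟩
  · rintro ⟨t, ht, rfl⟩
    exact ⟨t / c, by positivity, by rw [smul_smul, div_mul_cancel₀ _ hc.ne']⟩

theorem mem_ray_or_of_inner_rot_eq_zero {p u x : Plane} (hu : ‖u‖ = 1) (h : ⟪rot u, x - p⟫ = 0) :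
    x ∈ ray p u ∨ x ∈ ray p (-u) := by
  have h1 := eq_smul_of_inner_rot_eq_zero hu h
  rcases le_total 0 ⟪u, x - p⟫ with h2 | h2
  · exact Or.inl ⟨_, h2, by rw [← h1]; abel⟩
  · exact Or.inr ⟨-⟪u, x - p⟫, by linarith, by rw [neg_smul_neg, ← h1]; abel⟩

theorem exists_pos_of_mem_ray {p u x : Plane} (hx : x ∈ ray p u) (hxp : x ≠ p) :
    ∃ t : ℝ, 0 < t ∧ x = p + t • u := by
  obtain ⟨t, ht, rfl⟩ := hx
  refine ⟨t, lt_of_le_of_ne ht ?_, rfl⟩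
  rintro rfl
  simp at hxp

theorem eq_of_mem_ray {p u v x : Plane} (hu : ‖u‖ = 1) (hv : ‖v‖ = 1) (hx : x ∈ ray p u)
    (hx' : x ∈ ray p v) (hxp : x ≠ p) : u = v := by
  obtain ⟨t, ht, rfl⟩ := exists_pos_of_mem_ray hx hxp
  obtain ⟨s, hs, e⟩ := exists_pos_of_mem_ray hx' hxp
  have e' : t • u = s • v := add_left_cancel e
  have hn := congrArg norm e'
  rw [norm_smul, norm_smul, hu, hv, mul_one, mul_one, Real.norm_of_nonneg ht.le,
    Real.norm_of_nonneg hs.le] at hn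
  rw [hn] at e'
  exact smul_right_injective Plane hs.ne' e'

/-! ### Functions with kinks along the rays of a fan -/

/-- Away from the rays from `p` in the directions in the support of `w`, the function `φ` is
locally affine; the gradient changes by `w u` across the ray in the direction `u`. -/
structure HasKinks (φ : Plane → ℝ) (p : Plane) (w : Plane →₀ ℝ) : Prop where
  norm_eq_one : ∀ u ∈ w.support, ‖u‖ = 1
  regular : ∀ x, (∀ u ∈ w.support, x ∉ ray p u) → IsAffineNear φ x
  kink : ∀ u ∈ w.support, ∀ s : ℝ, 0 < s →
    IsAffineNear (fun y => φ y - w u * max ⟪rot u, y - p⟫ 0) (p + s • u)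

namespace HasKinks

variable {φ : Plane → ℝ} {p : Plane} {w : Plane →₀ ℝ}

theorem neg (h : HasKinks φ p w) : HasKinks (fun x => -φ x) p (-w) where
  norm_eq_one u hu := h.norm_eq_one u (by simpa using hu)
  regular x hx := (h.regular x (by simpa using hx)).neg
  kink u hu s hs := (h.kink u (by simpa using hu) s hs).neg.congr
    (Eventually.of_forall fun y => by simp only [Finsupp.coe_neg, Pi.neg_apply]; ring)

/-- In an open half-plane the kinks of `φ` can be subtracted. -/
theorem exists_halfPlane (h : HasKinks φ p w) {d : Plane} (hd0 : d ≠ 0)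
    (hd : ∀ u ∈ w.support, ⟪u, d⟫ ≠ 0) :
    ∃ A : Plane →ᵃ[ℝ] ℝ, (∀ᶠ y in 𝓝 (p - rot d), φ y = A y) ∧
      ∀ᶠ y in 𝓝 (p + rot d),
        φ y = A y + ⟪∑ u ∈ w.support with 0 < ⟪u, d⟫, w u • rot u, y - p⟫ := by
  set S := w.support.filter fun u => 0 < ⟪u, d⟫
  set D : Set Plane := {x | 0 < ⟪d, x - p⟫} with hD
  have hDc : Convex ℝ D := by
    have e : D = {x | ⟪d, p⟫ < ⟪d, x⟫} := by
      ext x; simp only [hD, Set.mem_ofPred_eq, inner_sub_right, sub_pos]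
    rw [e]
    exact convex_halfSpace_gt (innerSL ℝ d).isLinear _
  have hdd : 0 < ⟪d, d⟫ := real_inner_self_pos.2 hd0
  -- Inside `D` each hinge creases only along its own ray, the opposite ray lying outside;
  -- subtracting the hinges removes every kink in `D`.
  obtain ⟨A, hA⟩ := exists_affineMap_of_isPreconnected
    (f := fun y => φ y - ∑ u ∈ S, w u * max ⟪rot u, y - p⟫ 0) hDc.isPreconnected fun x hx => by
    have hxp : x ≠ p := by rintro rfl; simp [hD] at hx
    have hray : ∀ u ∈ w.support, x ∈ ray p u → u ∈ S := by
      rintro u hu hxu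
      obtain ⟨t, ht, rfl⟩ := exists_pos_of_mem_ray hxu hxp
      simp only [hD, Set.mem_ofPred_eq, add_sub_cancel_left, inner_smul_right] at hx
      exact Finset.mem_filter.2 ⟨hu, by rw [real_inner_comm]; exact pos_of_mul_pos_right hx ht.le⟩
    have hray' : ∀ u ∈ S, x ∉ ray p u → ⟪rot u, x - p⟫ ≠ 0 := by
      intro u hu hxu h0
      obtain ⟨hu, hu'⟩ := Finset.mem_filter.1 hu
      rcases mem_ray_or_of_inner_rot_eq_zero (h.norm_eq_one u hu) h0 with h1 | ⟨t, ht, rfl⟩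
      · exact hxu h1
      · simp only [hD, Set.mem_ofPred_eq, add_sub_cancel_left, inner_smul_right, inner_neg_right]
          at hx
        rw [real_inner_comm] at hu'
        nlinarith
    by_cases hex : ∃ u ∈ w.support, x ∈ ray p u
    · obtain ⟨u, hu, hxu⟩ := hex
      have huS := hray u hu hxu
      have hk : IsAffineNear (fun y => φ y - w u * max ⟪rot u, y - p⟫ 0) x := by
        obtain ⟨t, ht, rfl⟩ := exists_pos_of_mem_ray hxu hxp
        exact h.kink u hu t ht
      have hs : IsAffineNear (fun y => ∑ v ∈ S.erase u, w v * max ⟪rot v, y - p⟫ 0) x := by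
        refine IsAffineNear.sum _ fun v hv => (IsAffineNear.max_inner_sub ?_).const_mul _
        obtain ⟨hv1, hv2⟩ := Finset.mem_erase.1 hv
        refine hray' v hv2 fun hxv => hv1 ?_
        exact eq_of_mem_ray (h.norm_eq_one v (Finset.mem_filter.1 hv2).1) (h.norm_eq_one u hu)
          hxv hxu hxp
      refine (hk.sub hs).congr (Eventually.of_forall fun y => ?_)
      simp only [← Finset.add_sum_erase S (fun v => w v * max ⟪rot v, y - p⟫ 0) huS]
      ring
    · push Not at hex
      exact (h.regular x hex).sub (IsAffineNear.sum _ fun v hv =>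
        (IsAffineNear.max_inner_sub (hray' v hv (hex v (Finset.mem_filter.1 hv).1))).const_mul _)
  obtain ⟨C, hC⟩ := exists_affineMap (∑ u ∈ S, w u • rot u, -⟪∑ u ∈ S, w u • rot u, p⟫)
  have hC' : ∀ y, ⟪∑ u ∈ S, w u • rot u, y - p⟫ = C y := fun y => by
    rw [hC, inner_sub_right, sub_eq_add_neg]
  have hreg : ∀ e : ℝ, e ≠ 0 → IsAffineNear φ (p + e • rot d) := by
    intro e he
    refine h.regular _ fun u hu => ?_
    rintro ⟨t, ht, h1⟩
    have h2 : e • rot d = t • u := add_left_cancel h1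
    have h3 : ⟪t • u, d⟫ = 0 := by rw [← h2, inner_smul_left, inner_rot_self, mul_zero]
    rw [inner_smul_left] at h3
    rcases mul_eq_zero.1 h3 with h4 | h4
    · simp only [conj_trivial] at h4
      have h5 : ⟪e • rot d, e • rot d⟫ = 0 := by rw [h2, h4]; simp
      rw [inner_smul_left, inner_smul_right, inner_rot_rot] at h5
      simp only [conj_trivial] at h5
      have := mul_ne_zero he (mul_ne_zero he hdd.ne')
      exact this h5
    · exact hd u hu h4
  -- Points of `D` accumulate at the boundary points, which carries the affine germ from inside `D`
  -- to them.
  have hcl : ∀ e : ℝ, ∃ᶠ y in 𝓝 (p + e • rot d), y ∈ D := by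
    intro e
    refine mem_closure_iff_frequently.1 ?_
    have ht : Tendsto (fun t : ℝ => p + e • rot d + t • d) (𝓝[>] 0) (𝓝 (p + e • rot d)) := by
      have : Continuous fun t : ℝ => p + e • rot d + t • d := by fun_prop
      have h0 := this.tendsto 0
      simp only [zero_smul, add_zero] at h0
      exact h0.mono_left nhdsWithin_le_nhds
    refine mem_closure_of_tendsto ht ?_
    filter_upwards [self_mem_nhdsWithin] with t ht
    simp only [hD, Set.mem_ofPred_eq]
    rw [show p + e • rot d + t • d - p = e • rot d + t • d by abel, inner_add_right,
      inner_smul_right, inner_smul_right, real_inner_comm, inner_rot_self]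
    have : 0 < t := ht
    rw [mul_zero, zero_add]
    exact mul_pos this hdd
  have hcont : ∀ u : Plane, Continuous fun y : Plane => ⟪rot u, y - p⟫ := fun u => by fun_prop
  -- Near p - rot d all hinges vanish; near p + rot d all are active.
  refine ⟨A, ?_, ?_⟩
  · obtain ⟨B, hB⟩ := hreg (-1) (by norm_num)
    have hsum : ∀ᶠ y in 𝓝 (p + (-1 : ℝ) • rot d),
        ∑ u ∈ S, w u * max ⟪rot u, y - p⟫ 0 = 0 := by
      have : ∀ᶠ y in 𝓝 (p + (-1 : ℝ) • rot d), ∀ u ∈ S, ⟪rot u, y - p⟫ < 0 := by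
        refine (Finset.eventually_all S).2 fun u hu => ?_
        refine (hcont u).continuousAt.eventually_lt continuousAt_const ?_
        rw [add_sub_cancel_left, inner_smul_right, inner_rot_rot]
        linarith [(Finset.mem_filter.1 hu).2]
      filter_upwards [this] with y hy
      exact Finset.sum_eq_zero fun u hu => by rw [max_eq_right (hy u hu).le, mul_zero]
    obtain ⟨z, hzD, hz⟩ := ((hcl (-1)).and_eventually
      (eventually_eventually_nhds.2 (hB.and hsum))).exists
    have : A = B := affineMap_eq_of_eventuallyEq (x := z) (by
      filter_upwards [hz, hA z hzD] with y h1 h2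
      rw [← h2, h1.2, h1.1, sub_zero])
    rw [this, show p - rot d = p + (-1 : ℝ) • rot d by module]
    exact hB
  · obtain ⟨B, hB⟩ := hreg 1 one_ne_zero
    have hsum : ∀ᶠ y in 𝓝 (p + (1 : ℝ) • rot d),
        ∑ u ∈ S, w u * max ⟪rot u, y - p⟫ 0 = C y := by
      have : ∀ᶠ y in 𝓝 (p + (1 : ℝ) • rot d), ∀ u ∈ S, 0 < ⟪rot u, y - p⟫ := by
        refine (Finset.eventually_all S).2 fun u hu => ?_
        refine continuousAt_const.eventually_lt (hcont u).continuousAt ?_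
        rw [add_sub_cancel_left, inner_smul_right, inner_rot_rot]
        linarith [(Finset.mem_filter.1 hu).2]
      filter_upwards [this] with y hy
      rw [← hC', sum_inner]
      refine Finset.sum_congr rfl fun u hu => ?_
      rw [max_eq_left (hy u hu).le, inner_smul_left]
      simp
    obtain ⟨z, hzD, hz⟩ := ((hcl 1).and_eventually
      (eventually_eventually_nhds.2 (hB.and hsum))).exists
    have : A + C = B := affineMap_eq_of_eventuallyEq (x := z) (by
      filter_upwards [hz, hA z hzD] with y h1 h2
      rw [AffineMap.coe_add, Pi.add_apply, ← h2, h1.2, h1.1]; ring)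
    rw [one_smul] at hB
    filter_upwards [hB] with y hy
    rw [hy, ← this, hC', AffineMap.coe_add, Pi.add_apply]

/-- The kinks of a function are balanced. -/
theorem balanced (h : HasKinks φ p w) : ∑ u ∈ w.support, w u • u = 0 := by
  classical
  -- Each direction u is orthogonal to (1, τ) for at most one τ.
  obtain ⟨τ, hτ⟩ := Infinite.exists_notMem_finset (w.support.image fun u => -u 0 / u 1)
  set d : Plane := !₂[1, τ] with hd
  have hd0 : d 0 = 1 := rfl
  have hd1 : d 1 = τ := rfl
  have hdne : d ≠ 0 := fun e => by rw [e] at hd0; simp at hd0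
  have hdu : ∀ u ∈ w.support, ⟪u, d⟫ ≠ 0 := by
    intro u hu e
    rw [inner_eq_coord, hd0, hd1] at e
    have hu1 := coord_sq_of_norm_eq_one (h.norm_eq_one u hu)
    have hne : u 1 ≠ 0 := by
      intro h0
      rw [h0] at e hu1
      have : u 0 = 0 := by linarith
      rw [this] at hu1
      norm_num at hu1
    refine hτ (Finset.mem_image.2 ⟨u, hu, ?_⟩)
    rw [div_eq_iff hne]
    linarith
  obtain ⟨A, hA, hA'⟩ := h.exists_halfPlane hdne hdu
  -- The opposite half-plane has the same two boundary points in reverse order, which closes the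
  -- circuit around p.
  obtain ⟨B, hB, hB'⟩ := h.exists_halfPlane (d := -d) (neg_ne_zero.2 hdne)
    fun u hu => by rw [inner_neg_right]; exact neg_ne_zero.2 (hdu u hu)
  rw [rot_neg, sub_neg_eq_add] at hB
  rw [rot_neg, ← sub_eq_add_neg] at hB'
  have hneg : (w.support.filter fun u => 0 < ⟪u, -d⟫) =
      w.support.filter fun u => ¬ 0 < ⟪u, d⟫ := by
    refine Finset.filter_congr fun u hu => ?_
    have := hdu u hu
    rw [inner_neg_right, Left.neg_pos_iff, not_lt]
    exact ⟨le_of_lt, fun h => lt_of_le_of_ne h this⟩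
  rw [hneg] at hB'
  set c₁ := ∑ u ∈ w.support with 0 < ⟪u, d⟫, w u • rot u
  set c₂ := ∑ u ∈ w.support with ¬ 0 < ⟪u, d⟫, w u • rot u
  have hsum : c₁ + c₂ = ∑ u ∈ w.support, w u • rot u := Finset.sum_filter_add_sum_filter_not _ _ _
  obtain ⟨C₁, hC₁⟩ := exists_affineMap (c₁, -⟪c₁, p⟫)
  obtain ⟨C₂, hC₂⟩ := exists_affineMap (c₂, -⟪c₂, p⟫)
  have e₁ : B = A + C₁ := affineMap_eq_of_eventuallyEq (x := p + rot d) (by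
    filter_upwards [hB, hA'] with y h1 h2
    rw [← h1, h2, AffineMap.coe_add, Pi.add_apply, hC₁, inner_sub_right, sub_eq_add_neg])
  have e₂ : A = B + C₂ := affineMap_eq_of_eventuallyEq (x := p - rot d) (by
    filter_upwards [hA, hB'] with y h1 h2
    rw [← h1, h2, AffineMap.coe_add, Pi.add_apply, hC₂, inner_sub_right, sub_eq_add_neg])
  have h0 : c₁ + c₂ = 0 := by
    refine ext_inner_right ℝ fun v => ?_
    have h1 := congrArg (fun F : Plane →ᵃ[ℝ] ℝ => F (p + v)) e₁
    have h2 := congrArg (fun F : Plane →ᵃ[ℝ] ℝ => F (p + v)) e₂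
    simp only [AffineMap.coe_add, Pi.add_apply, hC₁, hC₂, inner_add_right] at h1 h2
    rw [inner_add_left, inner_zero_left]
    linarith
  have hrot : rot (∑ u ∈ w.support, w u • u) = ∑ u ∈ w.support, w u • rot u := by
    let R : Plane →ₗ[ℝ] Plane :=
      { toFun := rot, map_add' := rot_add, map_smul' := fun c u => rot_smul c u }
    change R _ = ∑ u ∈ w.support, w u • R u
    simp [map_sum]
  rw [← hsum, h0] at hrot
  rw [← norm_eq_zero, ← norm_rot, hrot, norm_zero]

end HasKinks

/-! ### Normal forms of functions with at most three kinks -/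

theorem hasLeastRep_of_line {φ : Plane → ℝ} (hφ : Continuous φ) {p n : Plane} (hn : n ≠ 0) {c : ℝ}
    (h : ∀ x, x ≠ p → IsAffineNear (fun y => φ y - c * max ⟪n, y - p⟫ 0) x) : HasLeastRep φ := by
  wlog hc : 0 ≤ c generalizing φ c
  · refine HasLeastRep.of_neg (this (c := -c) hφ.neg (fun x hx => ?_) (by linarith))
    exact (h x hx).neg.congr (Eventually.of_forall fun y => by ring)
  obtain ⟨A, hA⟩ := exists_affineMap_of_compl_singleton (hφ.sub (by fun_prop)) p h
  rcases hc.eq_or_lt with rfl | hc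
  · exact hasLeastRep_affine A fun x => by simpa using hA x
  obtain ⟨l, hl⟩ := exists_affineMap (c • n, -⟪c • n, p⟫)
  have hl' : ∀ x, l x = c * ⟪n, x - p⟫ := fun x => by
    rw [hl, inner_sub_right, inner_smul_left, inner_smul_left]; simp; ring
  have hnn : 0 < ⟪n, n⟫ := real_inner_self_pos.2 hn
  refine hasLeastRep_max A l (X := p + n) (Y := p - n) (fun x => ?_) ?_ ?_
  · have hAx : φ x - c * max ⟪n, x - p⟫ 0 = A x := hA x
    rw [hl', ← hAx, ← mul_zero c, ← mul_max_of_nonneg _ _ hc.le, mul_zero]; ring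
  · rw [hl', add_sub_cancel_left]; positivity
  · rw [hl', sub_sub_cancel_left, inner_neg_right]
    have := mul_pos hc hnn
    linarith

/-- Cramer's rule, with signs such that a vanishes along v, b along w, and a - b along v + w. -/
theorem exists_isChart (p : Plane) {v w : Plane} (hD : ⟪rot v, w⟫ ≠ 0) :
    ∃ a b : Plane →ᵃ[ℝ] ℝ, (∀ x, a x = ⟪rot v, x - p⟫) ∧ (∀ x, b x = -⟪rot w, x - p⟫) ∧
      IsChart a b p (⟪rot v, w⟫⁻¹ • w) (⟪rot v, w⟫⁻¹ • v) := by
  obtain ⟨a, ha⟩ := exists_affineMap (rot v, -⟪rot v, p⟫)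
  obtain ⟨b, hb⟩ := exists_affineMap (-rot w, ⟪rot w, p⟫)
  have ha' : ∀ x, a x = ⟪rot v, x - p⟫ := fun x => by
    simp only [ha]; rw [inner_sub_right, sub_eq_add_neg]
  have hb' : ∀ x, b x = -⟪rot w, x - p⟫ := fun x => by
    simp only [hb]; rw [inner_neg_left, inner_sub_right]; ring
  refine ⟨a, b, ha', hb', fun s t => ?_, fun s t => ?_, fun x => ?_⟩
  · rw [ha', add_assoc, add_sub_cancel_left]
    simp only [inner_add_right, inner_smul_right, inner_rot_self]
    field_simp
    ring
  · rw [hb', add_assoc, add_sub_cancel_left]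
    simp only [inner_add_right, inner_smul_right, inner_rot_self, inner_rot_comm w v]
    field_simp
    ring
  · have := inner_rot_smul v w (x - p)
    rw [ha', hb', neg_smul, smul_comm _ _ w, smul_comm _ _ v, add_assoc, ← sub_eq_add_neg,
      ← smul_sub, ← this, smul_smul, inv_mul_cancel₀ hD, one_smul]
    abel

/-- Weights are absorbed into the lengths of the vectors. For negative orientation the rays are a =
0 ≥ b, b = 0 ≥ a and a = b ≥ 0, the creases of max(a, b, 0); subtracting it leaves no kinks. -/
theorem hasLeastRep_of_tripod {φ : Plane → ℝ} (hφ : Continuous φ) {p v₁ v₂ v₃ : Plane}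
    (hv : v₁ + v₂ + v₃ = 0) (hD : ⟪rot v₁, v₂⟫ ≠ 0)
    (hreg : ∀ x, x ∉ ray p v₁ → x ∉ ray p v₂ → x ∉ ray p v₃ → IsAffineNear φ x)
    (h₁ : ∀ s : ℝ, 0 < s → IsAffineNear (fun y => φ y - max ⟪rot v₁, y - p⟫ 0) (p + s • v₁))
    (h₂ : ∀ s : ℝ, 0 < s → IsAffineNear (fun y => φ y - max ⟪rot v₂, y - p⟫ 0) (p + s • v₂))
    (h₃ : ∀ s : ℝ, 0 < s → IsAffineNear (fun y => φ y - max ⟪rot v₃, y - p⟫ 0) (p + s • v₃)) :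
    HasLeastRep φ := by
  wlog hneg : ⟪rot v₁, v₂⟫ < 0 generalizing v₁ v₂
  · refine this (by rw [add_comm v₂, hv]) ?_ (fun x a b c => hreg x b a c) h₂ h₁ ?_ <;>
      rw [inner_rot_comm]
    · exact neg_ne_zero.2 hD
    · exact neg_neg_of_pos (lt_of_le_of_ne (not_lt.1 hneg) hD.symm)
  obtain ⟨a, b, ha, hb, hc⟩ := exists_isChart p hD
  set D := ⟪rot v₁, v₂⟫
  have hca : Continuous a := a.continuous_of_finiteDimensional
  have hcb : Continuous b := b.continuous_of_finiteDimensional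
  have h21 : ⟪rot v₂, v₁⟫ = -D := by rw [inner_rot_comm]
  have hv₃ : v₃ = -(v₁ + v₂) := by rw [eq_neg_iff_add_eq_zero, add_comm, hv]
  have hrot : ∀ y, ⟪rot v₃, y - p⟫ = b y - a y := fun y => by
    rw [hv₃, rot_neg, rot_add, inner_neg_left, inner_add_left, ha, hb]; ring
  have hreg' : ∀ x, ¬(a x = 0 ∧ b x ≤ 0) → ¬(b x = 0 ∧ a x ≤ 0) → ¬(a x = b x ∧ 0 ≤ a x) →
      IsAffineNear φ x := by
    intro x n₁ n₂ n₃
    refine hreg x ?_ ?_ ?_ <;> rintro ⟨t, ht, rfl⟩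
    · refine n₁ ⟨?_, ?_⟩
      · rw [ha, add_sub_cancel_left, inner_smul_right, inner_rot_self, mul_zero]
      · rw [hb, add_sub_cancel_left, inner_smul_right, h21]; nlinarith
    · refine n₂ ⟨?_, ?_⟩
      · rw [hb, add_sub_cancel_left, inner_smul_right, inner_rot_self, mul_zero, neg_zero]
      · rw [ha, add_sub_cancel_left, inner_smul_right]; nlinarith
    · refine n₃ ⟨?_, ?_⟩
      · rw [ha, hb, add_sub_cancel_left, hv₃]
        simp only [inner_smul_right, inner_neg_right, inner_add_right, inner_rot_self, h21]
        ring
      · rw [ha, add_sub_cancel_left, hv₃]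
        simp only [inner_smul_right, inner_neg_right, inner_add_right, inner_rot_self]
        nlinarith
  have k₁ : ∀ x, a x = 0 → b x < 0 → IsAffineNear (fun y => φ y - max (a y) 0) x := by
    intro x e hx
    have hx' := hc.eq x
    rw [e, zero_smul, add_zero, smul_smul] at hx'
    have := h₁ (b x * D⁻¹) (mul_pos_of_neg_of_neg hx (inv_neg''.2 hneg))
    rw [← hx'] at this
    simpa only [ha] using this
  have k₂ : ∀ x, b x = 0 → a x < 0 → IsAffineNear (fun y => φ y - max (b y) 0) x := by
    intro x e hx
    have hx' := hc.eq x
    rw [e, zero_smul, add_zero, smul_smul] at hx'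
    have := h₂ (a x * D⁻¹) (mul_pos_of_neg_of_neg hx (inv_neg''.2 hneg))
    rw [← hx'] at this
    -- The hinge along v₂ is max(-b, 0) = max(b, 0) - b.
    refine (this.add (IsAffineNear.inner_sub (rot v₂) p)).congr (Eventually.of_forall fun y => ?_)
    rw [hb, max_neg_zero]
    ring
  have k₃ : ∀ x, a x = b x → 0 < a x → IsAffineNear (fun y => φ y - max (b y - a y) 0) x := by
    intro x e hx
    have hx' : x = p + (-(a x * D⁻¹)) • v₃ := by
      conv_lhs => rw [hc.eq x]
      rw [← e, hv₃]
      module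
    have := h₃ (-(a x * D⁻¹)) (neg_pos.2 (mul_neg_of_pos_of_neg hx (inv_neg''.2 hneg)))
    rw [← hx'] at this
    simpa only [hrot] using this
  obtain ⟨A, hA⟩ := exists_affineMap_of_compl_singleton
    (f := fun y => φ y - max (max (a y) (b y)) 0)
    (hφ.sub ((hca.max hcb).max continuous_const)) p fun x hx => by
      have zero : a x < 0 → b x < 0 → IsAffineNear (fun y => φ y - max (max (a y) (b y)) 0) x := by
        intro hax hbx
        refine (hreg' x ?_ ?_ ?_).congr ?_
        · rintro ⟨i, j⟩; linarith
        · rintro ⟨i, j⟩; linarith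
        · rintro ⟨i, j⟩; linarith
        · filter_upwards [hca.continuousAt.eventually_lt continuousAt_const hax,
            hcb.continuousAt.eventually_lt continuousAt_const hbx] with y h h'
          rw [max_eq_right (max_le h.le h'.le), sub_zero]
      rcases lt_trichotomy (a x) (b x) with hab | hab | hab
      · rcases lt_trichotomy (b x) 0 with h0 | h0 | h0
        · exact zero (hab.trans h0) h0
        · refine (k₂ x h0 (h0 ▸ hab)).congr ?_
          filter_upwards [hca.continuousAt.eventually_lt hcb.continuousAt hab] with y h
          rw [max_eq_right h.le]
        · refine ((hreg' x ?_ ?_ ?_).sub (IsAffineNear.affine b)).congr ?_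
          · rintro ⟨i, j⟩; linarith
          · rintro ⟨i, j⟩; linarith
          · rintro ⟨i, j⟩; linarith
          · filter_upwards [hca.continuousAt.eventually_lt hcb.continuousAt hab,
              continuousAt_const.eventually_lt hcb.continuousAt h0] with y h h'
            rw [max_eq_right h.le, max_eq_left h'.le]
      · rcases lt_trichotomy (a x) 0 with h0 | h0 | h0
        · exact zero h0 (hab ▸ h0)
        · refine absurd ?_ hx
          rw [hc.eq x, ← hab, h0]; simp
        · refine ((k₃ x hab h0).sub (IsAffineNear.affine a)).congr ?_
          filter_upwards [continuousAt_const.eventually_lt hca.continuousAt h0] with y h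
          rw [max_eq_left (h.le.trans (le_max_left _ _)), sub_sub, max_add, zero_add,
            sub_add_cancel, max_comm]
      · rcases lt_trichotomy (a x) 0 with h0 | h0 | h0
        · exact zero h0 (hab.trans h0)
        · refine (k₁ x h0 (h0 ▸ hab)).congr ?_
          filter_upwards [hcb.continuousAt.eventually_lt hca.continuousAt hab] with y h
          rw [max_eq_left h.le]
        · refine ((hreg' x ?_ ?_ ?_).sub (IsAffineNear.affine a)).congr ?_
          · rintro ⟨i, j⟩; linarith
          · rintro ⟨i, j⟩; linarith
          · rintro ⟨i, j⟩; linarith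
          · filter_upwards [hcb.continuousAt.eventually_lt hca.continuousAt hab,
              continuousAt_const.eventually_lt hca.continuousAt h0] with y h h'
            rw [max_eq_left h.le, max_eq_left h'.le]
  exact hasLeastRep_tripod hc fun x => by rw [← hA x]; ring

/-- With a concave third kink and positive orientation the rays are a = 0 ≤ b, b = 0 ≤ a and a = b ≥
0, the creases of max(0, min(a, b)). -/
theorem hasLeastRep_of_mixed {φ : Plane → ℝ} (hφ : Continuous φ) {p v₁ v₂ v₃ : Plane}
    (hv : v₁ + v₂ = v₃) (hD : ⟪rot v₁, v₂⟫ ≠ 0)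
    (hreg : ∀ x, x ∉ ray p v₁ → x ∉ ray p v₂ → x ∉ ray p v₃ → IsAffineNear φ x)
    (h₁ : ∀ s : ℝ, 0 < s → IsAffineNear (fun y => φ y - max ⟪rot v₁, y - p⟫ 0) (p + s • v₁))
    (h₂ : ∀ s : ℝ, 0 < s → IsAffineNear (fun y => φ y - max ⟪rot v₂, y - p⟫ 0) (p + s • v₂))
    (h₃ : ∀ s : ℝ, 0 < s → IsAffineNear (fun y => φ y + max ⟪rot v₃, y - p⟫ 0) (p + s • v₃)) :
    HasLeastRep φ := by
  wlog hpos : 0 < ⟪rot v₁, v₂⟫ generalizing v₁ v₂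
  · refine this (by rw [add_comm v₂, hv]) ?_ (fun x a b c => hreg x b a c) h₂ h₁ ?_ <;>
      rw [inner_rot_comm]
    · exact neg_ne_zero.2 hD
    · exact neg_pos.2 (lt_of_le_of_ne (not_lt.1 hpos) hD)
  obtain ⟨a, b, ha, hb, hc⟩ := exists_isChart p hD
  set D := ⟪rot v₁, v₂⟫
  have hca : Continuous a := a.continuous_of_finiteDimensional
  have hcb : Continuous b := b.continuous_of_finiteDimensional
  have h21 : ⟪rot v₂, v₁⟫ = -D := by rw [inner_rot_comm]
  have hrot : ∀ y, ⟪rot v₃, y - p⟫ = a y - b y := fun y => by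
    rw [← hv, rot_add, inner_add_left, ha, hb]; ring
  have hreg' : ∀ x, ¬(a x = 0 ∧ 0 ≤ b x) → ¬(b x = 0 ∧ 0 ≤ a x) → ¬(a x = b x ∧ 0 ≤ a x) →
      IsAffineNear φ x := by
    intro x n₁ n₂ n₃
    refine hreg x ?_ ?_ ?_ <;> rintro ⟨t, ht, rfl⟩
    · refine n₁ ⟨?_, ?_⟩
      · rw [ha, add_sub_cancel_left, inner_smul_right, inner_rot_self, mul_zero]
      · rw [hb, add_sub_cancel_left, inner_smul_right, h21]; nlinarith
    · refine n₂ ⟨?_, ?_⟩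
      · rw [hb, add_sub_cancel_left, inner_smul_right, inner_rot_self, mul_zero, neg_zero]
      · rw [ha, add_sub_cancel_left, inner_smul_right]; nlinarith
    · refine n₃ ⟨?_, ?_⟩
      · rw [ha, hb, add_sub_cancel_left, ← hv]
        simp only [inner_smul_right, inner_add_right, inner_rot_self, h21]
        ring
      · rw [ha, add_sub_cancel_left, ← hv]
        simp only [inner_smul_right, inner_add_right, inner_rot_self]
        nlinarith
  have k₁ : ∀ x, a x = 0 → 0 < b x → IsAffineNear (fun y => φ y - max (a y) 0) x := by
    intro x e hx
    have hx' := hc.eq x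
    rw [e, zero_smul, add_zero, smul_smul] at hx'
    have := h₁ (b x * D⁻¹) (mul_pos hx (inv_pos.2 hpos))
    rw [← hx'] at this
    simpa only [ha] using this
  have k₂ : ∀ x, b x = 0 → 0 < a x → IsAffineNear (fun y => φ y - max (b y) 0) x := by
    intro x e hx
    have hx' := hc.eq x
    rw [e, zero_smul, add_zero, smul_smul] at hx'
    have := h₂ (a x * D⁻¹) (mul_pos hx (inv_pos.2 hpos))
    rw [← hx'] at this
    refine (this.add (IsAffineNear.inner_sub (rot v₂) p)).congr (Eventually.of_forall fun y => ?_)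
    rw [hb, max_neg_zero]
    ring
  have k₃ : ∀ x, a x = b x → 0 < a x → IsAffineNear (fun y => φ y + max (a y - b y) 0) x := by
    intro x e hx
    have hx' : x = p + (a x * D⁻¹) • v₃ := by
      conv_lhs => rw [hc.eq x]
      rw [← e, ← hv]
      module
    have := h₃ (a x * D⁻¹) (mul_pos hx (inv_pos.2 hpos))
    rw [← hx'] at this
    simpa only [hrot] using this
  obtain ⟨A, hA⟩ := exists_affineMap_of_compl_singleton
    (f := fun y => φ y - max 0 (min (a y) (b y)))
    (hφ.sub (continuous_const.max (hca.min hcb))) p fun x hx => by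
      rcases lt_trichotomy (a x) (b x) with hab | hab | hab
      · have hev := hca.continuousAt.eventually_lt hcb.continuousAt hab
        rcases lt_trichotomy (a x) 0 with h0 | h0 | h0
        · refine (hreg' x ?_ ?_ ?_).congr ?_
          · rintro ⟨i, j⟩; linarith
          · rintro ⟨i, j⟩; linarith
          · rintro ⟨i, j⟩; linarith
          · filter_upwards [hev, hca.continuousAt.eventually_lt continuousAt_const h0] with y h h'
            rw [min_eq_left h.le, max_eq_left h'.le, sub_zero]
        · refine (k₁ x h0 (h0 ▸ hab)).congr ?_
          filter_upwards [hev] with y h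
          rw [min_eq_left h.le, max_comm]
        · refine ((hreg' x ?_ ?_ ?_).sub (IsAffineNear.affine a)).congr ?_
          · rintro ⟨i, j⟩; linarith
          · rintro ⟨i, j⟩; linarith
          · rintro ⟨i, j⟩; linarith
          · filter_upwards [hev, continuousAt_const.eventually_lt hca.continuousAt h0] with y h h'
            rw [min_eq_left h.le, max_eq_right h'.le]
      · rcases lt_trichotomy (a x) 0 with h0 | h0 | h0
        · refine (hreg' x ?_ ?_ ?_).congr ?_
          · rintro ⟨i, j⟩; linarith
          · rintro ⟨i, j⟩; linarith
          · rintro ⟨i, j⟩; linarith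
          · filter_upwards [hca.continuousAt.eventually_lt continuousAt_const h0] with y h
            rw [max_eq_left ((min_le_left _ _).trans h.le), sub_zero]
        · refine absurd ?_ hx
          rw [hc.eq x, ← hab, h0]; simp
        -- Here min(a, b) = a - max(a - b, 0), and it is positive nearby.
        · refine ((k₃ x hab h0).sub (IsAffineNear.affine a)).congr ?_
          filter_upwards [continuousAt_const.eventually_lt hca.continuousAt h0,
            continuousAt_const.eventually_lt hcb.continuousAt (hab ▸ h0)] with y h h'
          rw [max_eq_right (le_min h.le h'.le)]
          rcases le_total (a y) (b y) with g | g
          · rw [min_eq_left g, max_eq_right (sub_nonpos.2 g)]; ring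
          · rw [min_eq_right g, max_eq_left (sub_nonneg.2 g)]; ring
      · have hev := hcb.continuousAt.eventually_lt hca.continuousAt hab
        rcases lt_trichotomy (b x) 0 with h0 | h0 | h0
        · refine (hreg' x ?_ ?_ ?_).congr ?_
          · rintro ⟨i, j⟩; linarith
          · rintro ⟨i, j⟩; linarith
          · rintro ⟨i, j⟩; linarith
          · filter_upwards [hev, hcb.continuousAt.eventually_lt continuousAt_const h0] with y h h'
            rw [min_eq_right h.le, max_eq_left h'.le, sub_zero]
        · refine (k₂ x h0 (h0 ▸ hab)).congr ?_
          filter_upwards [hev] with y h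
          rw [min_eq_right h.le, max_comm]
        · refine ((hreg' x ?_ ?_ ?_).sub (IsAffineNear.affine b)).congr ?_
          · rintro ⟨i, j⟩; linarith
          · rintro ⟨i, j⟩; linarith
          · rintro ⟨i, j⟩; linarith
          · filter_upwards [hev, continuousAt_const.eventually_lt hcb.continuousAt h0] with y h h'
            rw [min_eq_right h.le, max_eq_right h'.le]
  exact hasLeastRep_mixed hc fun x => by rw [← hA x]; ring

/-- The gradient of `φ` changes by `c` across the open ray from `p` in the direction `u`. -/
def IsKink (φ : Plane → ℝ) (p u : Plane) (c : ℝ) : Prop :=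
  ∀ s : ℝ, 0 < s → IsAffineNear (fun y => φ y - c * max ⟪rot u, y - p⟫ 0) (p + s • u)

theorem IsKink.neg {φ : Plane → ℝ} {p u : Plane} {c : ℝ} (h : IsKink φ p u c) :
    IsKink (fun x => -φ x) p u (-c) := fun s hs =>
  (h s hs).neg.congr (Eventually.of_forall fun y => by ring)

theorem mul_max_inner_rot {c : ℝ} (hc : 0 < c) (u x : Plane) :
    c * max ⟪rot u, x⟫ 0 = max ⟪rot (c • u), x⟫ 0 := by
  rw [mul_max_of_nonneg _ _ hc.le, rot_smul, inner_smul_left, mul_zero]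
  simp

theorem IsKink.of_pos {φ : Plane → ℝ} {p u : Plane} {c : ℝ} (h : IsKink φ p u c) (hc : 0 < c)
    (s : ℝ) (hs : 0 < s) :
    IsAffineNear (fun y => φ y - max ⟪rot (c • u), y - p⟫ 0) (p + s • c • u) := by
  have := h (s * c) (mul_pos hs hc)
  rw [← smul_smul] at this
  simpa only [mul_max_inner_rot hc] using this

theorem hasLeastRep_of_three_aux {φ : Plane → ℝ} (hφ : Continuous φ) {p u₁ u₂ u₃ : Plane}
    {c₁ c₂ c₃ : ℝ} (hsum : c₁ • u₁ + c₂ • u₂ + c₃ • u₃ = 0) (hD : ⟪rot u₁, u₂⟫ ≠ 0)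
    (hc₁ : 0 < c₁) (hc₂ : 0 < c₂) (hc₃ : c₃ ≠ 0)
    (hreg : ∀ x, x ∉ ray p u₁ → x ∉ ray p u₂ → x ∉ ray p u₃ → IsAffineNear φ x)
    (h₁ : IsKink φ p u₁ c₁) (h₂ : IsKink φ p u₂ c₂) (h₃ : IsKink φ p u₃ c₃) :
    HasLeastRep φ := by
  have hD' : ⟪rot (c₁ • u₁), c₂ • u₂⟫ ≠ 0 := by
    rw [rot_smul, inner_smul_left, inner_smul_right]
    exact mul_ne_zero hc₁.ne' (mul_ne_zero hc₂.ne' hD)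
  rcases hc₃.lt_or_gt with hc | hc
  · have hc' : 0 < -c₃ := neg_pos.2 hc
    refine hasLeastRep_of_mixed hφ (p := p) (v₃ := (-c₃) • u₃) ?_ hD' (fun x => ?_)
      (h₁.of_pos hc₁) (h₂.of_pos hc₂) fun s hs => ?_
    · rw [neg_smul, eq_neg_iff_add_eq_zero, hsum]
    · rw [ray_smul hc₁, ray_smul hc₂, ray_smul hc']
      exact hreg x
    · exact (h₃.neg.of_pos hc' s hs).neg.congr (Eventually.of_forall fun y => by ring)
  · refine hasLeastRep_of_tripod hφ (p := p) hsum hD' (fun x => ?_)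
      (h₁.of_pos hc₁) (h₂.of_pos hc₂) (h₃.of_pos hc)
    rw [ray_smul hc₁, ray_smul hc₂, ray_smul hc]
    exact hreg x

/-- Two of three nonzero weights share a sign; permuting, and negating `φ` if needed, makes them the
first two and positive. The third sign selects tripod or mixed. -/
theorem hasLeastRep_of_three {φ : Plane → ℝ} (hφ : Continuous φ) {p u₁ u₂ u₃ : Plane}
    {c₁ c₂ c₃ : ℝ} (hsum : c₁ • u₁ + c₂ • u₂ + c₃ • u₃ = 0) (hD₁₂ : ⟪rot u₁, u₂⟫ ≠ 0)
    (hD₁₃ : ⟪rot u₁, u₃⟫ ≠ 0) (hD₂₃ : ⟪rot u₂, u₃⟫ ≠ 0)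
    (hc₁ : c₁ ≠ 0) (hc₂ : c₂ ≠ 0) (hc₃ : c₃ ≠ 0)
    (hreg : ∀ x, x ∉ ray p u₁ → x ∉ ray p u₂ → x ∉ ray p u₃ → IsAffineNear φ x)
    (h₁ : IsKink φ p u₁ c₁) (h₂ : IsKink φ p u₂ c₂) (h₃ : IsKink φ p u₃ c₃) :
    HasLeastRep φ := by
  have key : ∀ {ψ : Plane → ℝ} {d₁ d₂ d₃ : ℝ}, Continuous ψ →
      d₁ • u₁ + d₂ • u₂ + d₃ • u₃ = 0 → d₁ ≠ 0 → d₂ ≠ 0 → d₃ ≠ 0 →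
      (∀ x, x ∉ ray p u₁ → x ∉ ray p u₂ → x ∉ ray p u₃ → IsAffineNear ψ x) →
      IsKink ψ p u₁ d₁ → IsKink ψ p u₂ d₂ → IsKink ψ p u₃ d₃ →
      (0 < d₁ ∧ 0 < d₂) ∨ (0 < d₁ ∧ 0 < d₃) ∨ (0 < d₂ ∧ 0 < d₃) → HasLeastRep ψ := by
    intro ψ d₁ d₂ d₃ hψ hs e₁ e₂ e₃ hr k₁ k₂ k₃ h
    rcases h with ⟨i, j⟩ | ⟨i, j⟩ | ⟨i, j⟩
    · exact hasLeastRep_of_three_aux hψ hs hD₁₂ i j e₃ hr k₁ k₂ k₃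
    · exact hasLeastRep_of_three_aux hψ (by rw [← hs]; abel) hD₁₃ i j e₂
        (fun x a b c => hr x a c b) k₁ k₃ k₂
    · exact hasLeastRep_of_three_aux hψ (by rw [← hs]; abel) hD₂₃ i j e₁
        (fun x a b c => hr x c a b) k₂ k₃ k₁
  by_cases h : (0 < c₁ ∧ 0 < c₂) ∨ (0 < c₁ ∧ 0 < c₃) ∨ (0 < c₂ ∧ 0 < c₃)
  · exact key hφ hsum hc₁ hc₂ hc₃ hreg h₁ h₂ h₃ h
  · refine HasLeastRep.of_neg (key (d₁ := -c₁) (d₂ := -c₂) (d₃ := -c₃) hφ.neg ?_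
      (neg_ne_zero.2 hc₁) (neg_ne_zero.2 hc₂) (neg_ne_zero.2 hc₃)
      (fun x a b c => (hreg x a b c).neg) h₁.neg h₂.neg h₃.neg ?_)
    · rw [neg_smul, neg_smul, neg_smul, ← neg_add, ← neg_add, hsum, neg_zero]
    · simp only [neg_pos]
      rcases hc₁.lt_or_gt with a | a <;> rcases hc₂.lt_or_gt with b | b <;>
      rcases hc₃.lt_or_gt with c | c <;> tauto

/-- If all relations between the directions of the kinks are multiples of the one given by the
weights, then there are at most three kinks and `φ` has a least representation. -/
theorem HasKinks.hasLeastRep {φ : Plane → ℝ} (hφ : Continuous φ) {p : Plane} {w : Plane →₀ ℝ}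
    (h : HasKinks φ p w)
    (hw : ∀ w' : Plane →₀ ℝ, w'.support ⊆ w.support → ∑ u ∈ w.support, w' u • u = 0 →
      ∃ c : ℝ, w' = c • w) : HasLeastRep φ := by
  classical
  have hbal := h.balanced
  -- Extended by zero, a nontrivial relation on `T` is a nonzero multiple of `w`, hence has full
  -- support.
  have hrel : ∀ (T : Finset Plane) (r : Plane → ℝ), T ⊆ w.support → ∑ u ∈ T, r u • u = 0 →
      (∃ u ∈ T, r u ≠ 0) → T = w.support ∧ ∃ c : ℝ, c ≠ 0 ∧ ∀ u ∈ T, r u = c * w u := by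
    intro T r hT hr ⟨u₀, hu₀, hne⟩
    set w' : Plane →₀ ℝ := Finsupp.onFinset T (fun u => if u ∈ T then r u else 0)
      (by intro u hu; by_contra hh; simp [hh] at hu) with hw'
    have hval : ∀ u, w' u = if u ∈ T then r u else 0 := fun u => rfl
    obtain ⟨c, hc⟩ := hw w' (Finsupp.support_onFinset_subset.trans hT) (by
      rw [← hr, ← Finset.sum_subset hT]
      · exact Finset.sum_congr rfl fun u hu => by rw [hval, if_pos hu]
      · intro u _ hu; rw [hval, if_neg hu, zero_smul])
    have hval' : ∀ u, w' u = c * w u := fun u => by rw [hc]; simp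
    have hc0 : c ≠ 0 := by
      rintro rfl
      have := hval' u₀
      rw [hval, if_pos hu₀, zero_mul] at this
      exact hne this
    refine ⟨hT.antisymm fun u hu => ?_, c, hc0, fun u hu => ?_⟩
    · by_contra hn
      have h1 := hval' u
      rw [hval, if_neg hn] at h1
      exact mul_ne_zero hc0 (Finsupp.mem_support_iff.1 hu) h1.symm
    · rw [← hval', hval, if_pos hu]
  rcases w.support.eq_empty_or_nonempty with he | ⟨u₁, hu₁⟩
  · obtain ⟨A, hA⟩ := exists_affineMap_of_compl_singleton hφ p fun x _ =>
      h.regular x (by simp [he])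
    exact hasLeastRep_affine A hA
  have hn₁ := h.norm_eq_one u₁ hu₁
  have hu₁0 : u₁ ≠ 0 := by rintro rfl; simp at hn₁
  by_cases hopp : ∃ u ∈ w.support, -u ∈ w.support
  · obtain ⟨u, hu, hu'⟩ := hopp
    have hn := h.norm_eq_one u hu
    have hu0 : u ≠ 0 := by rintro rfl; simp at hn
    have hne : u ≠ -u := fun e => by
      have h2 : (2 : ℝ) • u = 0 := by rw [two_smul, eq_neg_iff_add_eq_zero.1 e]
      exact hu0 ((smul_eq_zero.1 h2).resolve_left two_ne_zero)
    -- The relation u + (-u) = 0 leaves no other kinks and makes the two weights equal.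
    obtain ⟨hT, c, hc, hcw⟩ := hrel {u, -u} (fun _ => 1) (by
      intro v hv; rcases Finset.mem_insert.1 hv with rfl | hv
      · exact hu
      · rwa [Finset.mem_singleton.1 hv]) (by rw [Finset.sum_pair hne]; simp) ⟨u, by simp⟩
    have hww : w (-u) = w u := by
      have h1 := hcw u (by simp)
      have h2 := hcw (-u) (by simp)
      exact mul_left_cancel₀ hc (h2.symm.trans h1)
    have hru : rot u ≠ 0 := by rw [← norm_ne_zero_iff, norm_rot, hn]; exact one_ne_zero
    refine hasLeastRep_of_line hφ (p := p) hru (c := w u) fun x hx => ?_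
    by_cases hx1 : x ∈ ray p u
    · obtain ⟨t, ht, rfl⟩ := exists_pos_of_mem_ray hx1 hx
      exact h.kink u hu t ht
    by_cases hx2 : x ∈ ray p (-u)
    · obtain ⟨t, ht, rfl⟩ := exists_pos_of_mem_ray hx2 hx
      refine ((h.kink (-u) hu' t ht).sub
        ((IsAffineNear.inner_sub (rot u) p).const_mul (w u))).congr
        (Eventually.of_forall fun y => ?_)
      rw [hww, rot_neg, inner_neg_left, max_neg_zero]
      ring
    · refine (h.regular x fun v hv => ?_).sub ((IsAffineNear.max_inner_sub fun h0 => ?_).const_mul _)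
      · rw [← hT] at hv
        rcases Finset.mem_insert.1 hv with rfl | hv
        · exact hx1
        · rwa [Finset.mem_singleton.1 hv]
      · exact (mem_ray_or_of_inner_rot_eq_zero hn h0).elim hx1 hx2
  push Not at hopp
  have hD : ∀ u ∈ w.support, ∀ v ∈ w.support, u ≠ v → ⟪rot u, v⟫ ≠ 0 := by
    intro u hu v hv huv h0
    have hn := h.norm_eq_one u hu
    have h1 := eq_smul_of_inner_rot_eq_zero hn h0
    have h2 : |⟪u, v⟫| = 1 := by
      have := congrArg norm h1
      rwa [norm_smul, hn, h.norm_eq_one v hv, mul_one, eq_comm] at this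
    rcases eq_or_eq_neg_of_abs_eq h2 with h3 | h3 <;> rw [h3] at h1
    · exact huv (by rw [h1, one_smul])
    · rw [neg_one_smul] at h1
      exact hopp u hu (h1 ▸ hv)
  -- Balancing excludes a single kink and, as directions are now pairwise independent, also exactly
  -- two.
  have hex₂ : ∃ u₂ ∈ w.support, u₂ ≠ u₁ := by
    by_contra! hall
    have : w.support = {u₁} := Finset.eq_singleton_iff_unique_mem.2 ⟨hu₁, hall⟩
    rw [this, Finset.sum_singleton] at hbal
    exact smul_ne_zero (Finsupp.mem_support_iff.1 hu₁) hu₁0 hbal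
  obtain ⟨u₂, hu₂, h21⟩ := hex₂
  have hex₃ : ∃ u₃ ∈ w.support, u₃ ≠ u₁ ∧ u₃ ≠ u₂ := by
    by_contra! hall
    have : w.support = {u₁, u₂} := by
      ext v
      rw [Finset.mem_insert, Finset.mem_singleton]
      constructor
      · intro hv
        by_cases hv1 : v = u₁
        · exact Or.inl hv1
        · exact Or.inr (hall v hv hv1)
      · rintro (rfl | rfl) <;> assumption
    rw [this, Finset.sum_pair h21.symm] at hbal
    have h1 : ⟪rot u₁, w u₁ • u₁ + w u₂ • u₂⟫ = 0 := by rw [hbal, inner_zero_right]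
    rw [inner_add_right, inner_smul_right, inner_smul_right, inner_rot_self, mul_zero,
      zero_add] at h1
    exact mul_ne_zero (Finsupp.mem_support_iff.1 hu₂) (hD u₁ hu₁ u₂ hu₂ h21.symm) h1
  obtain ⟨u₃, hu₃, h31, h32⟩ := hex₃
  have hsum3 : ∀ r : Plane → ℝ, ∑ u ∈ ({u₁, u₂, u₃} : Finset Plane), r u • u =
      r u₁ • u₁ + r u₂ • u₂ + r u₃ • u₃ := fun r => by
    rw [Finset.sum_insert (by simp [h21.symm, h31.symm]), Finset.sum_pair h32.symm, add_assoc]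
  have hD₁₂ := hD u₁ hu₁ u₂ hu₂ h21.symm
  -- Cramer's rule gives a relation among three directions, so there is no fourth.
  obtain ⟨hT, -⟩ := hrel {u₁, u₂, u₃}
    (fun u => if u = u₁ then ⟪rot u₂, u₃⟫ else if u = u₂ then -⟪rot u₁, u₃⟫ else ⟪rot u₁, u₂⟫)
    (by
      intro v hv
      simp only [Finset.mem_insert, Finset.mem_singleton] at hv
      rcases hv with rfl | rfl | rfl <;> assumption)
    (by
      rw [hsum3]
      simp only [if_true, h21, h31, h32, if_false]
      rw [inner_rot_smul u₁ u₂ u₃]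
      module) ⟨u₃, by simp, by simpa [h31, h32] using hD₁₂⟩
  rw [← hT, hsum3] at hbal
  refine hasLeastRep_of_three hφ hbal hD₁₂ (hD u₁ hu₁ u₃ hu₃ h31.symm)
    (hD u₂ hu₂ u₃ hu₃ h32.symm) (Finsupp.mem_support_iff.1 hu₁) (Finsupp.mem_support_iff.1 hu₂)
    (Finsupp.mem_support_iff.1 hu₃) (fun x a b c => h.regular x ?_) (h.kink u₁ hu₁)
    (h.kink u₂ hu₂) (h.kink u₃ hu₃)
  rw [← hT]
  simp [a, b, c]

/-! ### Complexes of rays with a common apex -/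

theorem isPolyhedron_ray (p : Plane) {u : Plane} (hu : ‖u‖ = 1) : IsPolyhedron (ray p u) := by
  classical
  refine ⟨{(rot u, ⟪rot u, p⟫), (-rot u, -⟪rot u, p⟫), (-u, -⟪u, p⟫)}, ?_⟩
  ext x
  simp only [Finset.mem_insert, Finset.mem_singleton, Set.mem_ofPred_eq, forall_eq_or_imp,
    forall_eq, inner_neg_left, neg_le_neg_iff]
  constructor
  · rintro ⟨t, ht, rfl⟩
    simp only [inner_add_right, inner_smul_right, inner_rot_self, mul_zero, add_zero, le_refl,
      true_and, real_inner_self_eq_norm_sq, hu]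
    linarith
  · rintro ⟨h1, h2, h3⟩
    have h0 : ⟪rot u, x - p⟫ = 0 := by rw [inner_sub_right]; linarith
    refine ⟨⟪u, x - p⟫, ?_, ?_⟩
    · rw [inner_sub_right]; linarith
    · rw [← eq_smul_of_inner_rot_eq_zero hu h0]; abel

theorem apex_mem_ray (p u : Plane) : p ∈ ray p u := ⟨0, le_rfl, by simp⟩

theorem add_mem_ray (p u : Plane) : p + u ∈ ray p u := ⟨1, zero_le_one, by simp⟩

theorem vectorSpan_eq_span {σ : Set Plane} {p u : Plane} (hp : p ∈ σ) (hu : p + u ∈ σ)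
    (h : ∀ x ∈ σ, ∃ c : ℝ, x = p + c • u) : vectorSpan ℝ σ = ℝ ∙ u := by
  rw [vectorSpan_eq_span_vsub_set_right ℝ hp]
  apply le_antisymm
  · rw [Submodule.span_le]
    rintro _ ⟨x, hx, rfl⟩
    obtain ⟨c, rfl⟩ := h x hx
    simp only [vsub_eq_sub, add_sub_cancel_left]
    exact Submodule.mem_span_singleton.2 ⟨c, rfl⟩
  · rw [Submodule.span_singleton_le_iff_mem]
    exact Submodule.subset_span ⟨p + u, hu, by simp⟩

theorem vectorSpan_ray (p u : Plane) : vectorSpan ℝ (ray p u) = ℝ ∙ u :=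
  vectorSpan_eq_span (apex_mem_ray p u) (add_mem_ray p u)
    (by rintro x ⟨t, -, rfl⟩; exact ⟨t, rfl⟩)

theorem ray_injOn (p : Plane) : Set.InjOn (ray p) {u | ‖u‖ = 1} := by
  intro u hu v hv e
  refine eq_of_mem_ray hu hv (add_mem_ray p u) (e ▸ add_mem_ray p u) fun h => ?_
  have h0 : u = 0 := by simpa using h
  rw [h0] at hu
  simp at hu

theorem isExposed_ray_inter {p u v : Plane} (hu : ‖u‖ = 1) (hv : ‖v‖ = 1) (huv : u ≠ v) :
    IsExposed ℝ (ray p u) (ray p u ∩ ray p v) := by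
  intro _
  refine ⟨-innerSL ℝ u, ?_⟩
  ext x
  have huu : ⟪u, u⟫ = (1 : ℝ) := by rw [real_inner_self_eq_norm_sq, hu]; norm_num
  constructor
  · rintro ⟨hx, hx'⟩
    have hxp : x = p := by
      by_contra hne
      exact huv (eq_of_mem_ray hu hv hx hx' hne)
    refine ⟨hx, ?_⟩
    rintro y ⟨t, ht, rfl⟩
    rw [hxp]
    simp only [neg_apply, innerSL_apply_apply, inner_add_right,
      inner_smul_right, huu]
    linarith
  · rintro ⟨hx, h⟩
    refine ⟨hx, ?_⟩
    have h1 := h p (apex_mem_ray p u)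
    obtain ⟨t, ht, rfl⟩ := hx
    simp only [neg_apply, innerSL_apply_apply, inner_add_right,
      inner_smul_right, huu] at h1
    have : t = 0 := by linarith
    rw [this, zero_smul, add_zero]
    exact apex_mem_ray p v

/-- The complex of the rays from `p` in the directions in the support of `w`, with weights `w`. -/
noncomputable def rayComplex (p : Plane) (w : Plane →₀ ℝ) (hw : ∀ u ∈ w.support, ‖u‖ = 1) :
    WeightedComplex where
  weight := w.mapDomain (ray p)
  isPolyhedron σ hσ := by
    classical
    obtain ⟨u, hu, rfl⟩ := Finset.mem_image.1 (Finsupp.mapDomain_support hσ)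
    exact isPolyhedron_ray p (hw u hu)
  finrank_eq_one σ hσ := by
    classical
    obtain ⟨u, hu, rfl⟩ := Finset.mem_image.1 (Finsupp.mapDomain_support hσ)
    rw [direction_affineSpan, vectorSpan_ray]
    refine finrank_span_singleton fun h0 => ?_
    have := hw u hu
    rw [h0] at this
    simp at this
  isFace σ hσ τ hτ hne := by
    classical
    obtain ⟨u, hu, rfl⟩ := Finset.mem_image.1 (Finsupp.mapDomain_support hσ)
    obtain ⟨v, hv, rfl⟩ := Finset.mem_image.1 (Finsupp.mapDomain_support hτ)
    exact isExposed_ray_inter (hw u hu) (hw v hv) fun e => hne (by rw [e])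

open Classical in
theorem germWeight_of_weight_eq {X : WeightedComplex} {p : Plane} {w : Plane →₀ ℝ}
    (hX : X.weight = w.mapDomain (ray p)) (q v : Plane) :
    X.germWeight q v = w.sum fun u c => if ∀ᶠ ε : ℝ in 𝓝[>] 0, q + ε • v ∈ ray p u then c else 0 := by
  have h1 : X.germWeight q v =
      X.weight.sum fun σ c => if ∀ᶠ ε : ℝ in 𝓝[>] 0, q + ε • v ∈ σ then c else 0 := by
    rw [WeightedComplex.germWeight, Finset.sum_filter]
    rfl
  rw [h1, hX, Finsupp.sum_mapDomain_index]
  · intro σ; simp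
  · intro σ c d; split_ifs <;> simp

theorem germ_apex_iff {p u v : Plane} (hu : ‖u‖ = 1) (hv : ‖v‖ = 1) :
    (∀ᶠ ε : ℝ in 𝓝[>] 0, p + ε • v ∈ ray p u) ↔ u = v := by
  constructor
  · intro h
    obtain ⟨ε, h1, h2⟩ := (h.and self_mem_nhdsWithin).exists
    have hε : (0 : ℝ) < ε := h2
    refine eq_of_mem_ray hu hv h1 ⟨ε, hε.le, rfl⟩ fun e => ?_
    have h3 : ε • v = 0 := by simpa using e
    have h4 : v = 0 := (smul_eq_zero.1 h3).resolve_left hε.ne'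
    rw [h4] at hv
    simp at hv
  · rintro rfl
    filter_upwards [self_mem_nhdsWithin] with ε hε
    exact ⟨ε, le_of_lt hε, rfl⟩

/-- A closed ray contains the limit point q, and off the apex q is relatively interior, so the
segment continues backwards. -/
theorem germ_neg {p q u v : Plane} (hu : ‖u‖ = 1) (hqp : q ≠ p)
    (h : ∀ᶠ ε : ℝ in 𝓝[>] 0, q + ε • v ∈ ray p u) :
    ∀ᶠ ε : ℝ in 𝓝[>] 0, q + ε • -v ∈ ray p u := by
  have huu : ⟪u, u⟫ = (1 : ℝ) := by rw [real_inner_self_eq_norm_sq, hu]; norm_num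
  have hmem : ∀ x ∈ ray p u, ⟪rot u, x - p⟫ = 0 ∧ 0 ≤ ⟪u, x - p⟫ := by
    rintro x ⟨t, ht, rfl⟩
    rw [add_sub_cancel_left, inner_smul_right, inner_smul_right, inner_rot_self, huu]
    constructor <;> linarith
  have hmem' : ∀ x, ⟪rot u, x - p⟫ = 0 → 0 ≤ ⟪u, x - p⟫ → x ∈ ray p u := fun x h1 h2 =>
    ⟨_, h2, by rw [← eq_smul_of_inner_rot_eq_zero hu h1]; abel⟩
  have hlim : ∀ n : Plane, Tendsto (fun ε : ℝ => ⟪n, q + ε • v - p⟫) (𝓝[>] 0) (𝓝 ⟪n, q - p⟫) := by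
    intro n
    have hc : Continuous fun ε : ℝ => ⟪n, q + ε • v - p⟫ := by fun_prop
    have h0 := hc.tendsto 0
    simp only [zero_smul, add_zero] at h0
    exact h0.mono_left nhdsWithin_le_nhds
  have e₁ : ⟪rot u, q - p⟫ = 0 := by
    refine tendsto_nhds_unique ((hlim (rot u)).congr' ?_) tendsto_const_nhds
    filter_upwards [h] with ε hε using (hmem _ hε).1
  have e₂ : 0 ≤ ⟪u, q - p⟫ := ge_of_tendsto (hlim u) (h.mono fun ε hε => (hmem _ hε).2)
  have e₃ : 0 < ⟪u, q - p⟫ := by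
    refine lt_of_le_of_ne e₂ fun e => hqp ?_
    have := eq_smul_of_inner_rot_eq_zero hu e₁
    rw [← e, zero_smul] at this
    exact sub_eq_zero.1 this
  have e₄ : ⟪rot u, v⟫ = 0 := by
    obtain ⟨ε, h1, h2⟩ := (h.and self_mem_nhdsWithin).exists
    have hε : (0 : ℝ) < ε := h2
    have := (hmem _ h1).1
    rw [show q + ε • v - p = (q - p) + ε • v by abel, inner_add_right, e₁, zero_add,
      inner_smul_right] at this
    exact (mul_eq_zero.1 this).resolve_left hε.ne'
  have hc : Continuous fun ε : ℝ => ⟪u, q + ε • -v - p⟫ := by fun_prop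
  have hev : ∀ᶠ ε : ℝ in 𝓝 0, 0 < ⟪u, q + ε • -v - p⟫ := by
    refine continuousAt_const.eventually_lt hc.continuousAt ?_
    simpa using e₃
  filter_upwards [nhdsWithin_le_nhds hev] with ε hε
  refine hmem' _ ?_ hε.le
  rw [show q + ε • -v - p = (q - p) + ε • -v by abel, inner_add_right, e₁, inner_smul_right,
    inner_neg_right, e₄]
  simp

theorem germWeight_apex {X : WeightedComplex} {p : Plane} {w : Plane →₀ ℝ}
    (hX : X.weight = w.mapDomain (ray p)) (hw : ∀ u ∈ w.support, ‖u‖ = 1) {v : Plane}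
    (hv : ‖v‖ = 1) : X.germWeight p v = w v := by
  classical
  rw [germWeight_of_weight_eq hX, Finsupp.sum]
  rw [Finset.sum_congr rfl fun u hu => by rw [germ_apex_iff (hw u hu) hv]]
  refine (Finset.sum_eq_single v (fun u _ hu => if_neg hu) fun h => ?_).trans (if_pos rfl)
  rw [if_pos rfl, Finsupp.notMem_support_iff.1 h]

/-- At the apex this is the given relation; elsewhere germ weights are even in the direction, so the
sum equals its own negative. -/
theorem rayComplex_isSignBalanced {p : Plane} {w : Plane →₀ ℝ} (hw : ∀ u ∈ w.support, ‖u‖ = 1)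
    (hbal : ∑ u ∈ w.support, w u • u = 0) : (rayComplex p w hw).IsSignBalanced := by
  classical
  intro q
  by_cases hq : q = p
  · subst hq
    rw [← hbal]
    rw [finsum_congr fun u => finsum_congr fun hu => by
      rw [germWeight_apex (X := rayComplex q w hw) rfl hw hu]]
    rw [← finsum_mem_finset_eq_sum]
    refine finsum_congr fun u => ?_
    by_cases hu : u ∈ w.support
    · rw [finsum_eq_if, finsum_eq_if, if_pos (hw u hu), if_pos hu]
    · rw [Finsupp.notMem_support_iff.1 hu]; simp
  · have hodd : ∀ v, (rayComplex p w hw).germWeight q (-v) = (rayComplex p w hw).germWeight q v := by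
      intro v
      rw [germWeight_of_weight_eq rfl, germWeight_of_weight_eq rfl, Finsupp.sum, Finsupp.sum]
      refine Finset.sum_congr rfl fun u hu => ?_
      congr 1
      refine propext ⟨fun h => ?_, germ_neg (hw u hu) hq⟩
      simpa using germ_neg (hw u hu) hq h
    set F : Plane → Plane := fun u =>
      ∑ᶠ (_ : ‖u‖ = 1), (rayComplex p w hw).germWeight q u • u with hF
    have hFneg : ∀ u, F (-u) = -F u := by
      intro u
      simp only [hF, norm_neg, hodd, smul_neg]
      rw [finsum_eq_if, finsum_eq_if]
      split_ifs <;> simp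
    have h1 : ∑ᶠ u, F u = -∑ᶠ u, F u := by
      conv_lhs => rw [← finsum_comp_equiv (Equiv.neg Plane)]
      rw [← finsum_neg_distrib]
      exact finsum_congr fun u => hFneg u
    have h2 : (2 : ℝ) • ∑ᶠ u, F u = 0 := by rw [two_smul, ← eq_neg_iff_add_eq_zero]; exact h1
    exact (smul_eq_zero.1 h2).resolve_left two_ne_zero

theorem mem_carrier_iff {X : WeightedComplex} {p : Plane} {w : Plane →₀ ℝ}
    (hX : X.weight = w.mapDomain (ray p)) (hw : ∀ u ∈ w.support, ‖u‖ = 1) (x : Plane) :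
    x ∈ X.carrier ↔ ∃ u ∈ w.support, x ∈ ray p u := by
  classical
  have : X.cells = w.support.image (ray p) := by
    rw [WeightedComplex.cells, hX, Finsupp.mapDomain_support_of_injOn]
    exact (ray_injOn p).mono hw
  simp [WeightedComplex.carrier, this]

/-- In an irreducible complex of rays, all relations between the directions are multiples of the
one given by the weights. -/
theorem exists_eq_smul_of_isIrreducible {X : WeightedComplex} {p : Plane} {w : Plane →₀ ℝ}
    (hX : X.weight = w.mapDomain (ray p)) (hw : ∀ u ∈ w.support, ‖u‖ = 1)
    (hbal : ∑ u ∈ w.support, w u • u = 0) (hirr : X.IsIrreducible) (w' : Plane →₀ ℝ)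
    (hs : w'.support ⊆ w.support) (hbal' : ∑ u ∈ w.support, w' u • u = 0) :
    ∃ c : ℝ, w' = c • w := by
  classical
  by_contra hne
  rcases eq_or_ne w 0 with rfl | hw0
  · exact hne ⟨0, by simpa using hs⟩
  have hs' : (w - w').support ⊆ w.support :=
    Finsupp.support_sub.trans (Finset.union_subset subset_rfl hs)
  have hu₁ : ∀ u ∈ w'.support, ‖u‖ = 1 := fun u hu => hw u (hs hu)
  have hu₂ : ∀ u ∈ (w - w').support, ‖u‖ = 1 := fun u hu => hw u (hs' hu)
  have hprop : ∀ (a b : Plane →₀ ℝ) (ha : ∀ u ∈ a.support, ‖u‖ = 1)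
      (hb : ∀ u ∈ b.support, ‖u‖ = 1),
      (rayComplex p a ha).IsProportion (rayComplex p b hb) → ∃ c : ℝ, a = c • b := by
    rintro a b ha hb ⟨c, hc⟩
    refine ⟨c, Finsupp.ext fun u => ?_⟩
    by_cases hu : ‖u‖ = 1
    · have := hc p u hu
      rw [germWeight_apex (X := rayComplex p a ha) rfl ha hu,
        germWeight_apex (X := rayComplex p b hb) rfl hb hu] at this
      simpa using this
    · rw [Finsupp.smul_apply, Finsupp.notMem_support_iff.1 (fun h => hu (ha u h)),
        Finsupp.notMem_support_iff.1 (fun h => hu (hb u h)), smul_zero]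
  -- Split the complex as w' + (w - w'). Proportionality either way would make w' a multiple of w,
  -- or w zero.
  refine hirr ⟨rayComplex p w' hu₁, rayComplex p (w - w') hu₂, rayComplex_isSignBalanced hu₁ ?_,
    rayComplex_isSignBalanced hu₂ ?_, ⟨?_, fun q v hv => ?_⟩, fun h => ?_, fun h => ?_⟩
  · rw [← hbal']
    refine Finset.sum_subset hs fun u _ hu => ?_
    rw [Finsupp.notMem_support_iff.1 hu, zero_smul]
  · rw [Finset.sum_subset hs' fun u _ hu => by
      rw [Finsupp.notMem_support_iff.1 hu, zero_smul]]
    simp only [Finsupp.sub_apply, sub_smul, Finset.sum_sub_distrib, hbal, hbal', sub_zero]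
  · ext x
    rw [Set.mem_union, mem_carrier_iff hX hw, mem_carrier_iff rfl hu₁, mem_carrier_iff rfl hu₂]
    constructor
    · rintro ⟨u, hu, hx⟩
      by_cases h : u ∈ w'.support
      · exact Or.inl ⟨u, h, hx⟩
      · refine Or.inr ⟨u, ?_, hx⟩
        rw [Finsupp.mem_support_iff, Finsupp.sub_apply, Finsupp.notMem_support_iff.1 h, sub_zero]
        exact Finsupp.mem_support_iff.1 hu
    · rintro (⟨u, hu, hx⟩ | ⟨u, hu, hx⟩)
      · exact ⟨u, hs hu, hx⟩
      · exact ⟨u, hs' hu, hx⟩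
  · rw [germWeight_of_weight_eq hX, germWeight_of_weight_eq (X := rayComplex p w' hu₁) rfl,
      germWeight_of_weight_eq (X := rayComplex p (w - w') hu₂) rfl, ← Finsupp.sum_add_index',
      add_sub_cancel]
    · intro u; simp
    · intro u c d; split_ifs <;> simp
  · obtain ⟨c, hc⟩ := hprop _ _ _ _ h
    have h1 : (1 + c) • w' = c • w := by
      rw [add_smul, one_smul]
      nth_rewrite 1 [hc]
      rw [smul_sub, sub_add_cancel]
    by_cases hc1 : 1 + c = 0
    · rw [hc1, zero_smul] at h1
      have hc0 : c ≠ 0 := by linarith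
      exact hw0 ((smul_eq_zero.1 h1.symm).resolve_left hc0)
    · refine hne ⟨(1 + c)⁻¹ * c, ?_⟩
      rw [mul_smul, ← h1, smul_smul, inv_mul_cancel₀ hc1, one_smul]
  · obtain ⟨c, hc⟩ := hprop _ _ _ _ h
    have h1 : w = (1 + c) • w' := by rw [add_smul, one_smul, ← hc]; abel
    have hc1 : 1 + c ≠ 0 := by
      intro h0
      rw [h0, zero_smul] at h1
      exact hw0 h1
    refine hne ⟨(1 + c)⁻¹, ?_⟩
    conv_rhs => rw [h1]
    rw [smul_smul, inv_mul_cancel₀ hc1, one_smul]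

/-! ### Fans -/

/-- The cells of a fan are rays and lines. -/
theorem exists_ray_or_line {σ : Set Plane} {p : Plane}
    (h1 : Module.finrank ℝ (affineSpan ℝ σ).direction = 1)
    (hc : ∀ x ∈ σ, ∀ t : ℝ, 0 ≤ t → p + t • (x - p) ∈ σ) :
    ∃ u : Plane, ‖u‖ = 1 ∧ p ∈ σ ∧ p + u ∈ σ ∧ (∀ x ∈ σ, ∃ c : ℝ, x = p + c • u) ∧
      (σ = ray p u ∨ σ = {x | ∃ c : ℝ, x = p + c • u}) := by
  rw [direction_affineSpan] at h1
  have hne : σ.Nonempty := by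
    by_contra he
    rw [Set.not_nonempty_iff_eq_empty.1 he, vectorSpan_empty, finrank_bot] at h1
    exact zero_ne_one h1
  obtain ⟨x₀, hx₀⟩ := hne
  have hp : p ∈ σ := by simpa using hc x₀ hx₀ 0 le_rfl
  have hex : ∃ x ∈ σ, x ≠ p := by
    by_contra! hall
    have : σ ⊆ {p} := fun x hx => hall x hx
    have h2 : vectorSpan ℝ σ ≤ ⊥ := (vectorSpan_mono ℝ this).trans (by simp)
    rw [le_bot_iff.1 h2, finrank_bot] at h1
    exact zero_ne_one h1
  obtain ⟨x₁, hx₁, hx₁p⟩ := hex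
  have hd : x₁ - p ≠ 0 := sub_ne_zero.2 hx₁p
  have hspan : ∀ x ∈ σ, ∃ c : ℝ, c • (x₁ - p) = x - p := by
    intro x hx
    have hm : ∀ y ∈ σ, y - p ∈ vectorSpan ℝ σ := fun y hy => vsub_mem_vectorSpan ℝ hy hp
    obtain ⟨c, hc⟩ := exists_smul_eq_of_finrank_eq_one h1
      (x := (⟨x₁ - p, hm x₁ hx₁⟩ : vectorSpan ℝ σ)) (fun h => hd (congrArg Subtype.val h))
      ⟨x - p, hm x hx⟩
    exact ⟨c, congrArg Subtype.val hc⟩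
  set u : Plane := ‖x₁ - p‖⁻¹ • (x₁ - p) with hu
  have hn : 0 < ‖x₁ - p‖ := norm_pos_iff.2 hd
  have hu1 : ‖u‖ = 1 := by
    rw [hu, norm_smul, norm_inv, norm_norm, inv_mul_cancel₀ hn.ne']
  have hxu : x₁ - p = ‖x₁ - p‖ • u := by
    rw [hu, smul_smul, mul_inv_cancel₀ hn.ne', one_smul]
  have hline : ∀ x ∈ σ, ∃ c : ℝ, x = p + c • u := by
    intro x hx
    obtain ⟨c, hc⟩ := hspan x hx
    refine ⟨c * ‖x₁ - p‖, ?_⟩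
    rw [mul_smul, ← hxu, hc]
    abel
  have hray : ray p u ⊆ σ := by
    rintro x ⟨t, ht, rfl⟩
    have := hc x₁ hx₁ (t * ‖x₁ - p‖⁻¹) (by positivity)
    rwa [mul_smul, ← hu] at this
  refine ⟨u, hu1, hp, hray (add_mem_ray p u), hline, ?_⟩
  by_cases hpos : ∀ x ∈ σ, x ∈ ray p u
  · exact Or.inl (Set.Subset.antisymm hpos hray)
  -- A point off the ray has a negative coordinate, and its dilates fill the opposite ray.
  · push Not at hpos
    obtain ⟨x, hx, hxr⟩ := hpos
    obtain ⟨c, rfl⟩ := hline x hx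
    have hcneg : c < 0 := not_le.1 fun h => hxr ⟨c, h, rfl⟩
    refine Or.inr (Set.Subset.antisymm hline ?_)
    rintro y ⟨e, rfl⟩
    rcases le_total 0 e with he | he
    · exact hray ⟨e, he, rfl⟩
    · have := hc _ hx (e / c) (div_nonneg_of_nonpos he hcneg.le)
      rwa [add_sub_cancel_left, smul_smul, div_mul_cancel₀ _ hcneg.ne] at this

theorem mem_intrinsicInterior_of_isOpen {σ O : Set Plane} {q : Plane} (hO : IsOpen O) (hq : q ∈ O)
    (hqσ : q ∈ affineSpan ℝ σ) (h : ∀ x ∈ affineSpan ℝ σ, x ∈ O → x ∈ σ) :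
    q ∈ intrinsicInterior ℝ σ := by
  refine mem_intrinsicInterior.2 ⟨⟨q, hqσ⟩, mem_interior.2 ⟨Subtype.val ⁻¹' O, ?_, ?_, hq⟩, rfl⟩
  · intro x hx
    exact h x x.2 hx
  · exact hO.preimage continuous_subtype_val

theorem mem_affineSpan_iff {σ : Set Plane} {p u : Plane} (hp : p ∈ σ) (hu : p + u ∈ σ)
    (h : ∀ x ∈ σ, ∃ c : ℝ, x = p + c • u) (x : Plane) :
    x ∈ affineSpan ℝ σ ↔ ∃ c : ℝ, x = p + c • u := by
  rw [← AffineSubspace.vsub_right_mem_direction_iff_mem (mem_affineSpan ℝ hp),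
    direction_affineSpan, vectorSpan_eq_span hp hu h, Submodule.mem_span_singleton]
  refine exists_congr fun c => ?_
  rw [vsub_eq_sub, eq_sub_iff_add_eq, add_comm, eq_comm]

/-- As rot u is normal to the cell, the hinge may be based at p instead of q. -/
theorem isAffineNear_sub_kink {X : WeightedComplex} {φ : Plane → ℝ}
    (hX : X.IsNonlinearityComplex φ) {σ : Set Plane} (hσ : σ ∈ X.cells) {p u : Plane}
    (hu : ‖u‖ = 1) (h : ∀ x ∈ σ, ∃ c : ℝ, x = p + c • u) {q : Plane}
    (hq : q ∈ intrinsicInterior ℝ σ) :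
    IsAffineNear (fun y => φ y - X.weight σ * max ⟪rot u, y - p⟫ 0) q := by
  obtain ⟨b, hb⟩ := hX.2 σ hσ q hq (rot u) (by rw [norm_rot, hu]) fun x hx y hy => by
    obtain ⟨c, rfl⟩ := h x hx
    obtain ⟨d, rfl⟩ := h y hy
    rw [add_sub_add_left_eq_sub, ← sub_smul, inner_smul_right, inner_rot_self, mul_zero]
  obtain ⟨c, hc⟩ := h q (intrinsicInterior_subset hq)
  refine ((IsAffineNear.const (φ q)).add (IsAffineNear.inner_sub b q)).congr ?_
  filter_upwards [hb] with y hy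
  have : ⟪rot u, y - q⟫ = ⟪rot u, y - p⟫ := by
    rw [hc, ← sub_sub, inner_sub_right _ (y - p), inner_smul_right, inner_rot_self, mul_zero, sub_zero]
  rw [hy, this]
  ring

theorem isAffineNear_of_notMem_carrier {X : WeightedComplex} {φ : Plane → ℝ}
    (hX : X.IsNonlinearityComplex φ) {x : Plane} (hx : x ∉ X.carrier) : IsAffineNear φ x := by
  rw [hX.1] at hx
  exact not_not.1 hx

/-- A line is the only cell of the fan that contains it. -/
theorem eq_of_line_mem {X : WeightedComplex} {p : Plane}
    (hfan : ∀ σ ∈ X.cells, ∀ x ∈ σ, ∀ t : ℝ, 0 ≤ t → p + t • (x - p) ∈ σ) {u : Plane}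
    (hu : ‖u‖ = 1) (hσ : {x | ∃ c : ℝ, x = p + c • u} ∈ X.cells) {τ : Set Plane}
    (hτ : τ ∈ X.cells) : τ = {x | ∃ c : ℝ, x = p + c • u} := by
  by_contra hne
  obtain ⟨v, hv, hpτ, -, hvl, -⟩ := exists_ray_or_line (X.finrank_eq_one τ hτ) (hfan τ hτ)
  set σ : Set Plane := {x | ∃ c : ℝ, x = p + c • u} with hσdef
  have hpσ : p ∈ σ := ⟨0, by simp⟩
  obtain ⟨l, hl⟩ := X.isFace σ hσ τ hτ (Ne.symm hne) ⟨p, hpσ, hpτ⟩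
  have hmem : p ∈ σ ∩ τ := ⟨hpσ, hpτ⟩
  rw [hl] at hmem
  have hle := hmem.2
  -- A linear functional maximal at p on a line through p is constant there, so the exposed face is
  -- the whole line.
  have h1 := hle (p + (1 : ℝ) • u) ⟨1, rfl⟩
  have h2 := hle (p + (-1 : ℝ) • u) ⟨-1, rfl⟩
  simp only [map_add, map_smul, smul_eq_mul] at h1 h2
  have hlu : l u = 0 := by linarith
  have hsub : σ ⊆ τ := by
    rintro x ⟨c, rfl⟩
    have : p + c • u ∈ σ ∩ τ := by
      rw [hl]
      refine ⟨⟨c, rfl⟩, ?_⟩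
      rintro y ⟨d, rfl⟩
      simp [hlu]
    exact this.2
  obtain ⟨c, hc⟩ := hvl (p + u) (hsub ⟨1, by simp⟩)
  have huv : u = c • v := add_left_cancel hc
  have hc0 : c ≠ 0 := by
    rintro rfl
    rw [zero_smul] at huv
    rw [huv] at hu
    simp at hu
  refine hne (Set.Subset.antisymm (fun x hx => ?_) hsub)
  obtain ⟨d, rfl⟩ := hvl x hx
  refine ⟨d / c, ?_⟩
  rw [huv, smul_smul, div_mul_cancel₀ _ hc0]

theorem IsPolyhedron.isClosed {P : Set Plane} (h : IsPolyhedron P) : IsClosed P := by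
  obtain ⟨s, rfl⟩ := h
  have : {x : Plane | ∀ c ∈ s, ⟪c.1, x⟫ ≤ c.2} = ⋂ c ∈ s, {x : Plane | ⟪c.1, x⟫ ≤ c.2} := by
    ext x; simp
  rw [this]
  exact isClosed_biInter fun c _ => isClosed_le (by fun_prop) continuous_const

theorem IsPiecewiseLinear.continuous {φ : Plane → ℝ} (h : IsPiecewiseLinear φ) :
    Continuous φ := by
  obtain ⟨S, hS, hcov, haff⟩ := h
  refine (locallyFinite_of_finite fun P : S => (P : Set Plane)).continuous ?_
    (fun P => (hS P P.2).isClosed) fun P => ?_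
  · ext x
    obtain ⟨P, hP, hx⟩ := hcov x
    simp only [Set.mem_iUnion, Set.mem_univ, iff_true]
    exact ⟨⟨P, hP⟩, hx⟩
  · obtain ⟨a, ha⟩ := haff P P.2
    exact a.continuous_of_finiteDimensional.continuousOn.congr ha

/-- A fan with a line as a cell is that line alone. Otherwise all cells are rays, and the weights
transfer to their directions. -/
theorem hasLeastRep_of_isFan {φ : Plane → ℝ} (hφ : Continuous φ) {X : WeightedComplex}
    (hX : X.IsNonlinearityComplex φ) (hfan : X.IsFan) (hirr : X.IsIrreducible) :
    HasLeastRep φ := by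
  classical
  obtain ⟨p, hfan⟩ := hfan
  choose! d hd using fun σ (hσ : σ ∈ X.cells) =>
    exists_ray_or_line (X.finrank_eq_one σ hσ) (hfan σ hσ)
  by_cases hline : ∃ σ ∈ X.cells, σ = {x | ∃ c : ℝ, x = p + c • d σ}
  · obtain ⟨σ, hσ, hσl⟩ := hline
    obtain ⟨hu, hp, hpu, hl, -⟩ := hd σ hσ
    have hru : rot (d σ) ≠ 0 := by rw [← norm_ne_zero_iff, norm_rot, hu]; exact one_ne_zero
    refine hasLeastRep_of_line hφ (p := p) hru (c := X.weight σ) fun x _ => ?_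
    by_cases hx : x ∈ σ
    · refine isAffineNear_sub_kink hX hσ hu hl
        (mem_intrinsicInterior_of_isOpen isOpen_univ (Set.mem_univ x) (mem_affineSpan ℝ hx) ?_)
      intro y hy _
      rw [hσl]
      exact (mem_affineSpan_iff hp hpu hl y).1 hy
    · refine (isAffineNear_of_notMem_carrier hX ?_).sub
        ((IsAffineNear.max_inner_sub fun h0 => hx ?_).const_mul _)
      · rintro ⟨τ, hτ, hxτ⟩
        have := eq_of_line_mem hfan hu (hσl ▸ hσ) hτ
        rw [← hσl] at this
        exact hx (this ▸ hxτ)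
      · rw [hσl]
        refine ⟨⟪d σ, x - p⟫, ?_⟩
        rw [← eq_smul_of_inner_rot_eq_zero hu h0]
        abel
  push Not at hline
  have hray : ∀ σ ∈ X.cells, σ = ray p (d σ) := fun σ hσ =>
    (hd σ hσ).2.2.2.2.resolve_right (hline σ hσ)
  set w : Plane →₀ ℝ := X.weight.mapDomain d with hw_def
  have hw : ∀ u ∈ w.support, ∃ σ ∈ X.cells, d σ = u := fun u hu =>
    Finset.mem_image.1 (Finsupp.mapDomain_support hu)
  have hwn : ∀ u ∈ w.support, ‖u‖ = 1 := by
    intro u hu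
    obtain ⟨σ, hσ, rfl⟩ := hw u hu
    exact (hd σ hσ).1
  -- Rebuilding the ray from the direction of a cell returns the cell.
  have hXw : X.weight = w.mapDomain (ray p) := by
    rw [hw_def, ← Finsupp.mapDomain_comp]
    conv_lhs => rw [← Finsupp.mapDomain_id (v := X.weight)]
    exact Finsupp.mapDomain_congr fun σ hσ => hray σ hσ
  have hkinks : HasKinks φ p w := by
    refine ⟨hwn, fun x hx => isAffineNear_of_notMem_carrier hX fun hxX => ?_, fun u hu s hs => ?_⟩
    · obtain ⟨u, hu, hxu⟩ := (mem_carrier_iff hXw hwn x).1 hxX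
      exact hx u hu hxu
    · have hwu : X.weight (ray p u) = w u := by
        rw [hXw]
        exact Finsupp.mapDomain_apply' {u | ‖u‖ = 1} w hwn (ray_injOn p) (hwn u hu)
      obtain ⟨σ, hσ, rfl⟩ := hw u hu
      obtain ⟨hn, hp, hpu, hl, -⟩ := hd σ hσ
      rw [← hray σ hσ] at hwu
      rw [← hwu]
      -- This open half-plane meets the spanned line in the ray without its apex.
      refine isAffineNear_sub_kink hX hσ hn hl
        (mem_intrinsicInterior_of_isOpen (O := {x | 0 < ⟪d σ, x - p⟫})
          (isOpen_lt continuous_const (by fun_prop)) ?_ ?_ ?_)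
      · simp only [Set.mem_ofPred_eq, add_sub_cancel_left, inner_smul_right,
          real_inner_self_eq_norm_sq, hn]
        simpa using hs
      · exact (mem_affineSpan_iff hp hpu hl _).2 ⟨s, rfl⟩
      · intro x hx hx0
        obtain ⟨c, rfl⟩ := (mem_affineSpan_iff hp hpu hl x).1 hx
        simp only [Set.mem_ofPred_eq, add_sub_cancel_left, inner_smul_right,
          real_inner_self_eq_norm_sq, hn] at hx0
        exact (hray σ hσ).ge ⟨c, by linarith, rfl⟩
  exact hkinks.hasLeastRep hφ fun w' hs hb =>
    exists_eq_smul_of_isIrreducible hXw hwn hkinks.balanced hirr w' hs hb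

end TropicalFan

theorem theorem1 (φ : TropicalFan.Plane → ℝ) (hφ : TropicalFan.IsPiecewiseLinear φ)
    (hV : ∃ X : TropicalFan.WeightedComplex,
      X.IsNonlinearityComplex φ ∧ X.IsFan ∧ X.IsIrreducible) :
    ∃ g h : TropicalFan.Signomial,
      TropicalFan.IsMlenMinimal φ g h ∧
      (∀ g' h' : TropicalFan.Signomial, TropicalFan.IsMlenMinimal φ g' h' →
        ∃ a : TropicalFan.Plane →ᵃ[ℝ] ℝ, ∀ x,
          g'.eval x = g.eval x + a x ∧ h'.eval x = h.eval x + a x) ∧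
      TropicalFan.IsFlenMinimal φ [g] [h] ∧
      (∀ gs hs : List TropicalFan.Signomial, TropicalFan.IsFlenMinimal φ gs hs →
        ∃ a : TropicalFan.Plane →ᵃ[ℝ] ℝ, ∀ x,
          TropicalFan.tropProd gs x = g.eval x + a x ∧
          TropicalFan.tropProd hs x = h.eval x + a x) := by
  obtain ⟨X, hX, hfan, hirr⟩ := hV
  exact (TropicalFan.hasLeastRep_of_isFan hφ.continuous hX hfan hirr).exists_minimal
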